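/- Let $(M,J,g)$ be a smooth almost Hermitian manifold: $g$ is a Riemannian metric and $J$ an almost complex structure on $M$ with $g(JX,JY)=g(X,Y)$. Let $\nabla$ be the Levi-Civita connection of $g$, let $R(X,Y)=[\nabla_X,\nabla_Y]-\nabla_{[X,Y]}$, and for a local orthonormal frame $(e_i)$ put $$\operatorname{div}J=\sum_i(\nabla_{e_i}J)e_i,\qquad \operatorname{Ric}X=\sum_iR(X,e_i)e_i,\qquad \operatorname{tr}\nabla^2X=\sum_i\bigl(\nabla_{e_i}\nabla_{e_i}X-\nabla_{\nabla_{e_i}e_i}X\bigr).$$ Let $T^{\mathbb C}M=T'M\oplus T''M$ be the splitting of the complexified tangent bundle into the $\pm\mathrm i$-eigenspaces of $J$, with components written $X=X'+X''$, and extend $g$ and $\nabla$ complex-linearly. Suppose that the vector field $\sigma=J\operatorname{div}J$ satisfies $$g(\nabla_Z\sigma,W)+g(\nabla_W\sigma,Z)=g(\sigma,Z)\,g(\sigma,W)\qquad\text{for all } Z,W\in T'M,$$ and $$\Bigl(\operatorname{tr}\nabla^2\sigma+\operatorname{Ric}\sigma-\nabla_\sigma\sigma-2\Bigl(\sum_j\bigl(\nabla_{Z_j}(\nabla_{\overline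 Z_j}\sigma)''+\nabla_{(\nabla_{Z_j}\sigma)'}\overline Z_j\bigr)-\nabla_{\sigma'}\sigma''\Bigr)\Bigr)'=0,$$ where around each point $Z_j=\tfrac1{\sqrt2}(e_j-\mathrm iJe_j)$, $j=1,\dots,n$, is a local Hermitian frame, i.e. $(e_1,\dots,e_n,Je_1,\dots,Je_n)$ is a smooth local orthonormal frame (the left-hand side does not depend on its choice). Let $(N,J^N,h)$ be a $(1,2)$-symplectic almost Hermitian manifold, i.e. the $(1,2)$-part of $\mathrm d\Omega$ vanishes for $\Omega(X,Y)=h(X,J^NY)$. Then every holomorphic map $\varphi:M\to N$ (a smooth map with $\mathrm d\varphi\circ J=J^N\circ\mathrm d\varphi$) is biharmonic, i.e. it satisfies the Euler-Lagrange equation of the bienergy, $$\tau_2(\varphi)=\sum_i\Bigl(\nabla^\varphi_{e_i}\nabla^\varphi_{e_i}-\nabla^\varphi_{\nabla_{e_i}e_i}\Bigr)\tau(\varphi)+\sum_iR^N\bigl(\tau(\varphi),\mathrm d\varphi(e_i)\bigr)\mathrm d\varphi(e_i)=0,$$ where $\nabla^\varphi$ is the pull-back connection on $\varphi^{-1}TN$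 and $\tau(\varphi)=\operatorname{tr}\nabla\mathrm d\varphi$ is the tension field. -/

import Mathlib

open Bundle
open scoped Manifold ContDiff Topology

noncomputable section

namespace BiharmonicHolomorphic

/-! ## Riemannian geometry

`M` is a smooth manifold without boundary, modelled on the finite-dimensional real vector space `E`,
with a Riemannian metric `inner ℝ` on its tangent spaces. A tangent vector `v` at `x` is extended
to a smooth local vector field `FiberBundle.extend E v` (with constant components in the chart at
`x`) whenever the value of a tensor at `x` is read off from a formula for vector fields. -/

section Riemannian

variable {E : Type*} [NormedAddCommGroup E] [NormedSpace ℝ E] [FiniteDimensional ℝ E]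
  {M : Type*} [TopologicalSpace M] [ChartedSpace E M] [IsManifold 𝓘(ℝ, E) ∞ M]

instance instFiniteDimensionalTangent (x : M) :
    FiniteDimensional ℝ (TangentSpace 𝓘(ℝ, E) x) :=
  inferInstanceAs (FiniteDimensional ℝ E)

variable (E M) in
/-- Vector fields on `M` (no regularity built in). -/
abbrev VectorField : Type _ := Π x : M, TangentSpace 𝓘(ℝ, E) x

/-- Smoothness of a vector field on a set. -/
def SmoothOn (X : VectorField E M) (U : Set M) : Prop :=
  ContMDiffOn 𝓘(ℝ, E) (𝓘(ℝ, E).prod 𝓘(ℝ, E)) ∞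
    (fun x ↦ Bundle.TotalSpace.mk' E x (X x) : M → TangentBundle 𝓘(ℝ, E) M) U

/-- The local extension of a tangent vector to a vector field. -/
abbrev localExt {x : M} (v : TangentSpace 𝓘(ℝ, E) x) : VectorField E M := FiberBundle.extend E v

variable [RiemannianBundle (fun x : M ↦ TangentSpace 𝓘(ℝ, E) x)]

/-- The Koszul expression, equal to `g(∇_X Y, Z)` at `x` for the Levi-Civita connection `∇`. -/
def koszul (X Y Z : VectorField E M) (x : M) : ℝ :=
  (1 / 2) *
    (mvfderiv 𝓘(ℝ, E) (fun y ↦ inner ℝ (Y y) (Z y)) x (X x)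
      + mvfderiv 𝓘(ℝ, E) (fun y ↦ inner ℝ (X y) (Z y)) x (Y x)
      - mvfderiv 𝓘(ℝ, E) (fun y ↦ inner ℝ (X y) (Y y)) x (Z x)
      + inner ℝ (VectorField.mlieBracket 𝓘(ℝ, E) X Y x) (Z x)
      - inner ℝ (VectorField.mlieBracket 𝓘(ℝ, E) X Z x) (Y x)
      - inner ℝ (VectorField.mlieBracket 𝓘(ℝ, E) Y Z x) (X x))

/-- An orthonormal basis of the tangent space at `x`, used to write metric traces. -/
abbrev onb (x : M) :
    OrthonormalBasis (Fin (Module.finrank ℝ (TangentSpace 𝓘(ℝ, E) x))) ℝ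
      (TangentSpace 𝓘(ℝ, E) x) :=
  stdOrthonormalBasis ℝ (TangentSpace 𝓘(ℝ, E) x)

/-- The Levi-Civita connection of the metric: `nabla Y x v` is `∇_v Y`, the tangent vector at `x`
determined by the Koszul formula. -/
def nabla (Y : VectorField E M) (x : M) (v : TangentSpace 𝓘(ℝ, E) x) :
    TangentSpace 𝓘(ℝ, E) x :=
  ∑ i, koszul (localExt v) Y (localExt (onb x i)) x • onb x i

/-- The curvature tensor `R(u, v) w`, from
`R(X, Y) Z = ∇_X ∇_Y Z - ∇_Y ∇_X Z - ∇_[X, Y] Z`. -/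
def curvature (x : M) (u v w : TangentSpace 𝓘(ℝ, E) x) : TangentSpace 𝓘(ℝ, E) x :=
  nabla (fun y ↦ nabla (localExt w) y (localExt v y)) x u
    - nabla (fun y ↦ nabla (localExt w) y (localExt u y)) x v
    - nabla (localExt w) x (VectorField.mlieBracket 𝓘(ℝ, E) (localExt u) (localExt v) x)

/-- The Ricci operator `Ric v = ∑ R(v, e_i) e_i`. -/
def ricci (x : M) (v : TangentSpace 𝓘(ℝ, E) x) : TangentSpace 𝓘(ℝ, E) x :=
  ∑ i, curvature x v (onb x i) (onb x i)

/-- The rough Laplacian `tr ∇² Y`, the metric trace of the tensor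
`(u, V) ↦ ∇_u ∇_V Y - ∇_{∇_u V} Y`. -/
def roughLaplacian (Y : VectorField E M) (x : M) : TangentSpace 𝓘(ℝ, E) x :=
  ∑ i, (nabla (fun y ↦ nabla Y y (localExt (onb x i) y)) x (onb x i)
    - nabla Y x (nabla (localExt (onb x i)) x (onb x i)))

end Riemannian

/-! ## Maps between Riemannian manifolds -/

section Maps

variable {E : Type*} [NormedAddCommGroup E] [NormedSpace ℝ E] [FiniteDimensional ℝ E]
  {M : Type*} [TopologicalSpace M] [ChartedSpace E M] [IsManifold 𝓘(ℝ, E) ∞ M]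
  [RiemannianBundle (fun x : M ↦ TangentSpace 𝓘(ℝ, E) x)]
  {F : Type*} [NormedAddCommGroup F] [NormedSpace ℝ F] [FiniteDimensional ℝ F]
  {N : Type*} [TopologicalSpace N] [ChartedSpace F N] [IsManifold 𝓘(ℝ, F) ∞ N]
  [RiemannianBundle (fun p : N ↦ TangentSpace 𝓘(ℝ, F) p)]

variable (E F) in
/-- The differential of `φ` at `x`. -/
abbrev dmap (φ : M → N) (x : M) :
    TangentSpace 𝓘(ℝ, E) x →L[ℝ] TangentSpace 𝓘(ℝ, F) (φ x) :=
  mfderiv 𝓘(ℝ, E) 𝓘(ℝ, F) φ x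

/-- The pull-back `∇^φ_v V` of the Levi-Civita connection of `N` to sections `V` of `φ⁻¹TN`.
Writing `V = ∑ V^k (E_k ∘ φ)` in the coordinate frame `E_k` of the chart of `N` at `φ x`, it is
`∑ (dV^k(v) E_k + V^k ∇_{dφ(v)} E_k)`; the first sum is the derivative of `V` read in the
trivialization of `TN` at `φ x`. -/
def nablaAlong (φ : M → N) (V : Π x : M, TangentSpace 𝓘(ℝ, F) (φ x)) (x : M)
    (v : TangentSpace 𝓘(ℝ, E) x) : TangentSpace 𝓘(ℝ, F) (φ x) :=
  (trivializationAt F (TangentSpace 𝓘(ℝ, F) : N → Type _) (φ x)).symm (φ x)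
      (mvfderiv 𝓘(ℝ, E)
        (fun y ↦ (trivializationAt F (TangentSpace 𝓘(ℝ, F) : N → Type _) (φ x)
          ⟨φ y, V y⟩).2) x v)
    + nabla (localExt (V x)) (φ x) (dmap E F φ x v)

/-- The second fundamental form
`∇dφ(u, v) = ∇^φ_u (dφ(V)) - dφ(∇_u V)`, where `V` extends `v`. -/
def secondFundamentalForm (φ : M → N) (x : M) (u v : TangentSpace 𝓘(ℝ, E) x) :
    TangentSpace 𝓘(ℝ, F) (φ x) :=
  nablaAlong φ (fun y ↦ dmap E F φ y (localExt v y)) x u - dmap E F φ x (nabla (localExt v) x u)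

variable (E F) in
/-- The tension field `τ(φ) = tr ∇dφ`. -/
def tension (φ : M → N) (x : M) : TangentSpace 𝓘(ℝ, F) (φ x) :=
  ∑ i, secondFundamentalForm φ x (onb x i : TangentSpace 𝓘(ℝ, E) x) (onb x i)

variable (E) in
/-- The rough Laplacian `tr (∇^φ)² V` of a section `V` of `φ⁻¹TN`, the metric trace of
`(u, W) ↦ ∇^φ_u ∇^φ_W V - ∇^φ_{∇_u W} V`. -/
def roughLaplacianAlong (φ : M → N) (V : Π x : M, TangentSpace 𝓘(ℝ, F) (φ x)) (x : M) :
    TangentSpace 𝓘(ℝ, F) (φ x) :=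
  ∑ i, (nablaAlong φ (fun y ↦ nablaAlong φ V y
        (localExt (onb x i : TangentSpace 𝓘(ℝ, E) x) y)) x (onb x i)
    - nablaAlong φ V x (nabla (localExt (onb x i)) x (onb x i)))

variable (E) in
/-- The operator `Ric^φ v = ∑ R^N(v, dφ(e_i)) dφ(e_i)`. -/
def ricciAlong (φ : M → N) (x : M) (v : TangentSpace 𝓘(ℝ, F) (φ x)) :
    TangentSpace 𝓘(ℝ, F) (φ x) :=
  ∑ i, curvature (φ x) v (dmap E F φ x (onb x i)) (dmap E F φ x (onb x i))

variable (E F) in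
/-- The bitension field `τ₂(φ) = (tr (∇^φ)² + Ric^φ)(τ(φ))`. -/
def bitension (φ : M → N) (x : M) : TangentSpace 𝓘(ℝ, F) (φ x) :=
  roughLaplacianAlong E φ (tension E F φ) x + ricciAlong E φ x (tension E F φ x)

variable (E F) in
/-- `φ` is biharmonic: it satisfies the Euler-Lagrange equation `τ₂(φ) = 0` of the bienergy. -/
def IsBiharmonic (φ : M → N) : Prop :=
  ∀ x : M, bitension E F φ x = 0

end Maps

/-! ## Almost Hermitian geometry -/

section AlmostHermitian

variable {E : Type*} [NormedAddCommGroup E] [NormedSpace ℝ E] [FiniteDimensional ℝ E]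
  {M : Type*} [TopologicalSpace M] [ChartedSpace E M] [IsManifold 𝓘(ℝ, E) ∞ M]

variable (E M) in
/-- Fields of endomorphisms of the tangent spaces. -/
abbrev EndField : Type _ :=
  Π x : M, TangentSpace 𝓘(ℝ, E) x →L[ℝ] TangentSpace 𝓘(ℝ, E) x

/-- A vector `a + i b` of the complexified tangent space `T_x M ⊗ ℂ`, stored as the pair
`(a, b)` of its real and imaginary parts. -/
abbrev CTangent (x : M) : Type _ := TangentSpace 𝓘(ℝ, E) x × TangentSpace 𝓘(ℝ, E) x

variable (E M) in
/-- Complex vector fields, that is, sections of `TM ⊗ ℂ`. -/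
abbrev CVectorField : Type _ := Π x : M, CTangent (E := E) x

/-- A real tangent vector as a complex one. -/
def ofReal {x : M} (v : TangentSpace 𝓘(ℝ, E) x) : CTangent (E := E) x := (v, 0)

/-- Complex conjugation. -/
def cconj {x : M} (z : CTangent (E := E) x) : CTangent (E := E) x := (z.1, -z.2)

/-- Multiplication by the imaginary unit. -/
def mulI {x : M} (z : CTangent (E := E) x) : CTangent (E := E) x := (-z.2, z.1)

/-- The complex linear extension of `J`. -/
def complexJ (J : EndField E M) {x : M} (z : CTangent (E := E) x) : CTangent (E := E) x :=
  (J x z.1, J x z.2)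

/-- `z ∈ T'M`, the `i`-eigenspace of `J`. -/
def MemT' (J : EndField E M) {x : M} (z : CTangent (E := E) x) : Prop :=
  complexJ J z = mulI z

/-- `z ∈ T''M`, the `(-i)`-eigenspace of `J`. -/
def MemT'' (J : EndField E M) {x : M} (z : CTangent (E := E) x) : Prop :=
  complexJ J z = -mulI z

/-- The `T'M`-component `z' = (z - i J z) / 2`. -/
def part' (J : EndField E M) {x : M} (z : CTangent (E := E) x) : CTangent (E := E) x :=
  (1 / 2 : ℝ) • (z - mulI (complexJ J z))

/-- The `T''M`-component `z'' = (z + i J z) / 2`. -/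
def part'' (J : EndField E M) {x : M} (z : CTangent (E := E) x) : CTangent (E := E) x :=
  (1 / 2 : ℝ) • (z + mulI (complexJ J z))

variable [RiemannianBundle (fun x : M ↦ TangentSpace 𝓘(ℝ, E) x)]

/-- The complex bilinear extension of the metric `g`. -/
def complexMetric {x : M} (z w : CTangent (E := E) x) : ℂ :=
  ⟨inner ℝ z.1 w.1 - inner ℝ z.2 w.2, inner ℝ z.1 w.2 + inner ℝ z.2 w.1⟩

/-- The complex bilinear extension `∇_z W` of the Levi-Civita connection. -/
def cnabla (W : CVectorField E M) (x : M) (z : CTangent (E := E) x) : CTangent (E := E) x :=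
  (nabla (fun y ↦ (W y).1) x z.1 - nabla (fun y ↦ (W y).2) x z.2,
   nabla (fun y ↦ (W y).2) x z.1 + nabla (fun y ↦ (W y).1) x z.2)

/-- `(M, J, g)` is almost Hermitian: `J` is a smooth almost complex structure and an isometry. -/
structure IsAlmostHermitian (J : EndField E M) : Prop where
  smooth : ContMDiff 𝓘(ℝ, E) (𝓘(ℝ, E).prod 𝓘(ℝ, E →L[ℝ] E)) ∞
    (fun x ↦ Bundle.TotalSpace.mk' (E →L[ℝ] E)
      (E := fun x : M ↦ TangentSpace 𝓘(ℝ, E) x →L[ℝ] TangentSpace 𝓘(ℝ, E) x) x (J x))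
  sq_eq_neg : ∀ (x : M) (v : TangentSpace 𝓘(ℝ, E) x), J x (J x v) = -v
  isometry : ∀ (x : M) (v w : TangentSpace 𝓘(ℝ, E) x),
    inner ℝ (J x v) (J x w) = inner ℝ v w

/-- The covariant derivative `(∇_u J) v = ∇_u (J V) - J ∇_u V`, where `V` extends `v`. -/
def nablaJ (J : EndField E M) (x : M) (u v : TangentSpace 𝓘(ℝ, E) x) :
    TangentSpace 𝓘(ℝ, E) x :=
  nabla (fun y ↦ J y (localExt v y)) x u - J x (nabla (localExt v) x u)

/-- The divergence `div J = ∑ (∇_{e_i} J) e_i`. -/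
def divJ (J : EndField E M) : VectorField E M :=
  fun x ↦ ∑ i, nablaJ J x (onb x i) (onb x i)

/-- The vector field `σ = J div J`. -/
def sigma (J : EndField E M) : VectorField E M :=
  fun x ↦ J x (divJ J x)

/-- The fundamental two-form `Ω(X, Y) = g(X, J Y)`. -/
def fundamentalForm (J : EndField E M) (x : M) (u v : TangentSpace 𝓘(ℝ, E) x) : ℝ :=
  inner ℝ u (J x v)

/-- The exterior derivative of the fundamental form at `x`:
`dΩ(X, Y, Z) = X Ω(Y, Z) - Y Ω(X, Z) + Z Ω(X, Y) - Ω([X, Y], Z) + Ω([X, Z], Y) - Ω([Y, Z], X)`,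
where `X, Y, Z` extend `u, v, w`. -/
def dFundamentalForm (J : EndField E M) (x : M) (u v w : TangentSpace 𝓘(ℝ, E) x) : ℝ :=
  mvfderiv 𝓘(ℝ, E) (fun y ↦ fundamentalForm J y (localExt v y) (localExt w y)) x u
    - mvfderiv 𝓘(ℝ, E) (fun y ↦ fundamentalForm J y (localExt u y) (localExt w y)) x v
    + mvfderiv 𝓘(ℝ, E) (fun y ↦ fundamentalForm J y (localExt u y) (localExt v y)) x w
    - fundamentalForm J x (VectorField.mlieBracket 𝓘(ℝ, E) (localExt u) (localExt v) x) w
    + fundamentalForm J x (VectorField.mlieBracket 𝓘(ℝ, E) (localExt u) (localExt w) x) v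
    - fundamentalForm J x (VectorField.mlieBracket 𝓘(ℝ, E) (localExt v) (localExt w) x) u

/-- The complex trilinear extension of `dΩ`. -/
def complexDFundamentalForm (J : EndField E M) (x : M) (z₁ z₂ z₃ : CTangent (E := E) x) : ℂ :=
  ⟨dFundamentalForm J x z₁.1 z₂.1 z₃.1 - dFundamentalForm J x z₁.1 z₂.2 z₃.2
      - dFundamentalForm J x z₁.2 z₂.1 z₃.2 - dFundamentalForm J x z₁.2 z₂.2 z₃.1,
   dFundamentalForm J x z₁.2 z₂.1 z₃.1 + dFundamentalForm J x z₁.1 z₂.2 z₃.1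
      + dFundamentalForm J x z₁.1 z₂.1 z₃.2 - dFundamentalForm J x z₁.2 z₂.2 z₃.2⟩

/-- `(M, J, g)` is `(1,2)`-symplectic: the `(1,2)`-part of `dΩ` vanishes. -/
def IsOneTwoSymplectic (J : EndField E M) : Prop :=
  ∀ (x : M) (z w₁ w₂ : CTangent (E := E) x), MemT' J z → MemT'' J w₁ → MemT'' J w₂ →
    complexDFundamentalForm J x z w₁ w₂ = 0

/-- The first-order condition
`g(∇_Z σ, W) + g(∇_W σ, Z) = g(σ, Z) g(σ, W)` for all `Z, W` in `T'M`. -/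
def SymmetricCondition (J : EndField E M) : Prop :=
  ∀ (x : M) (z w : CTangent (E := E) x), MemT' J z → MemT' J w →
    complexMetric (cnabla (fun y ↦ ofReal (sigma J y)) x z) w
      + complexMetric (cnabla (fun y ↦ ofReal (sigma J y)) x w) z
    = complexMetric (ofReal (sigma J x)) z * complexMetric (ofReal (sigma J x)) w

/-- `e₁, …, eₙ` are smooth vector fields on `U` such that `e₁, …, eₙ, J e₁, …, J eₙ` is an
orthonormal basis of the tangent space at each point of `U`. -/
structure IsAdaptedFrameOn (J : EndField E M) {n : ℕ} (e : Fin n → VectorField E M)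
    (U : Set M) : Prop where
  smooth : ∀ j, SmoothOn (e j) U
  orthonormal : ∀ y ∈ U, Orthonormal ℝ
    (Sum.elim (fun j ↦ e j y) (fun j ↦ J y (e j y)) : Fin n ⊕ Fin n → TangentSpace 𝓘(ℝ, E) y)
  card : 2 * n = Module.finrank ℝ E

/-- The member `Z = (e - i J e) / √2` of the Hermitian frame built on an adapted frame. -/
def hermitianVector (J : EndField E M) (e : VectorField E M) : CVectorField E M :=
  fun y ↦ (Real.sqrt 2)⁻¹ • (ofReal (e y) - mulI (ofReal (J y (e y))))

/-- The third-order condition at `x`, with respect to the Hermitian frame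
`Z_j = (e_j - i J e_j) / √2`: the `T'M`-component of
`tr ∇²σ + Ric σ - ∇_σ σ
  - 2 (∑ (∇_{Z_j} (∇_{conj Z_j} σ)'' + ∇_{(∇_{Z_j} σ)'} (conj Z_j)) - ∇_{σ'} σ'')` vanishes. -/
def VectorConditionAt (J : EndField E M) {n : ℕ} (e : Fin n → VectorField E M) (x : M) : Prop :=
  let σ : CVectorField E M := fun y ↦ ofReal (sigma J y)
  let Z : Fin n → CVectorField E M := fun j ↦ hermitianVector J (e j)
  part' J
    (ofReal (roughLaplacian (sigma J) x + ricci x (sigma J x) - nabla (sigma J) x (sigma J x))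
      - (2 : ℝ) •
        ((∑ j, (cnabla (fun y ↦ part'' J (cnabla σ y (cconj (Z j y)))) x (Z j x)
            + cnabla (fun y ↦ cconj (Z j y)) x (part' J (cnabla σ x (Z j x)))))
          - cnabla (fun y ↦ part'' J (σ y)) x (part' J (σ x)))) = 0

/-- The third-order condition holds on `M`: around every point it holds with respect to a local
Hermitian frame. -/
def VectorCondition (J : EndField E M) : Prop :=
  ∀ x : M, ∃ (U : Set M) (n : ℕ) (e : Fin n → VectorField E M),
    IsOpen U ∧ x ∈ U ∧ IsAdaptedFrameOn J e U ∧ VectorConditionAt J e x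

end AlmostHermitian

section Holomorphic

variable {E : Type*} [NormedAddCommGroup E] [NormedSpace ℝ E]
  {M : Type*} [TopologicalSpace M] [ChartedSpace E M]
  {F : Type*} [NormedAddCommGroup F] [NormedSpace ℝ F]
  {N : Type*} [TopologicalSpace N] [ChartedSpace F N]

/-- A holomorphic map of almost complex manifolds: a smooth map with `dφ ∘ J = J ∘ dφ`. -/
structure IsHolomorphic (JM : EndField E M) (JN : EndField F N) (φ : M → N) : Prop where
  smooth : ContMDiff 𝓘(ℝ, E) 𝓘(ℝ, F) ∞ φ
  commutes : ∀ (x : M) (v : TangentSpace 𝓘(ℝ, E) x),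
    mfderiv 𝓘(ℝ, E) 𝓘(ℝ, F) φ x (JM x v) = JN (φ x) (mfderiv 𝓘(ℝ, E) 𝓘(ℝ, F) φ x v)

end Holomorphic

end BiharmonicHolomorphic

end

open BiharmonicHolomorphic

/-! Write `D(u, v) = J (∇_u J) v + (∇_{J u} J) v`, a bilinear map with metric trace `2 σ` that
vanishes on `(1,2)`-symplectic manifolds. Differentiating `dφ ∘ J = J ∘ dφ` shows that the second
fundamental form `B = ∇dφ` of a holomorphic map into such a manifold satisfies
`2 (B(u, v) + B(J u, J v)) = -dφ(D(u, v) + D(v, u))`; taking traces, `τ(φ) = -dφ(σ)`.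

Let `S(u, v) = g(∇_u σ, v) + g(∇_v σ, u) - g(σ, u) g(σ, v)`. Commuting covariant derivatives along
`φ` turns the bitension field of a map with `τ(φ) = -dφ(σ)` into
`τ₂(φ) = -dφ(tr ∇²σ + Ric σ - ∇_σ σ) - ⟨S, B⟩`, where `⟨S, B⟩ = ∑ S(e_i, e_j) B(e_i, e_j)`.
The first hypothesis says that `S` is invariant under `J`, so that `2 ⟨S, B⟩ = -dφ(⟨S, D⟩)`. The
second says that `2 (tr ∇²σ + Ric σ - ∇_σ σ) = ⟨S, D⟩`, because the `T'M`-component of the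
derivative of a `T''M`-field along a `T'M`-vector is algebraic in the field and is given by `D`. -/

noncomputable section

namespace BiharmonicHolomorphic

section Coordinates

lemma eventuallyEq_comp_chartAt {H M α : Type*} [TopologicalSpace H] [TopologicalSpace M]
    [ChartedSpace H M] {x₀ y : M} (hy : y ∈ (chartAt H x₀).source) {f : M → α} {f' : H → α}
    (hf : f' =ᶠ[𝓝 (chartAt H x₀ y)] fun p ↦ f ((chartAt H x₀).symm p)) :
    f =ᶠ[𝓝 y] f' ∘ chartAt H x₀ := by
  filter_upwards [((chartAt H x₀).continuousAt hy).eventually hf,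
    (chartAt H x₀).open_source.mem_nhds hy] with z hz hz'
  rw [Function.comp_apply, hz, (chartAt H x₀).left_inv hz']

lemma eventuallyEq_nhds_chartAt {H M α : Type*} [TopologicalSpace H] [TopologicalSpace M]
    [ChartedSpace H M] {x₀ y : M} (hy : y ∈ (chartAt H x₀).source) {f g : H → α} :
    f =ᶠ[𝓝 (chartAt H x₀ y)] g ↔ f ∘ chartAt H x₀ =ᶠ[𝓝 y] g ∘ chartAt H x₀ := by
  rw [← (chartAt H x₀).map_nhds_eq hy, Filter.EventuallyEq, Filter.eventually_map]
  rfl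

variable {E : Type*} [NormedAddCommGroup E] [NormedSpace ℝ E]
  {F : Type*} [NormedAddCommGroup F] [NormedSpace ℝ F]
  {M : Type*} [TopologicalSpace M] [ChartedSpace E M] [IsManifold 𝓘(ℝ, E) ∞ M]

lemma contDiffAt_of_contMDiffAt {x₀ : M} {p : E} (hp : p ∈ (chartAt E x₀).target) {f : M → F}
    {f' : E → F} (hf : f' =ᶠ[𝓝 p] fun p ↦ f ((chartAt E x₀).symm p))
    (h : ContMDiffAt 𝓘(ℝ, E) 𝓘(ℝ, F) ∞ f ((chartAt E x₀).symm p)) :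
    ContDiffAt ℝ ∞ f' p := by
  have hc : ContMDiffAt 𝓘(ℝ, E) 𝓘(ℝ, E) ∞ (chartAt E x₀).symm p :=
    contMDiffOn_chart_symm.contMDiffAt ((chartAt E x₀).open_target.mem_nhds hp)
  exact (h.comp p hc).contDiffAt.congr_of_eventuallyEq hf

lemma contMDiffAt_of_contDiffAt {x₀ y : M} (hy : y ∈ (chartAt E x₀).source) {f : M → F}
    {f' : E → F} (hf : f' =ᶠ[𝓝 (chartAt E x₀ y)] fun p ↦ f ((chartAt E x₀).symm p))
    (h : ContDiffAt ℝ ∞ f' (chartAt E x₀ y)) :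
    ContMDiffAt 𝓘(ℝ, E) 𝓘(ℝ, F) ∞ f y :=
  (h.contMDiffAt.comp y
    (contMDiffOn_chart.contMDiffAt ((chartAt E x₀).open_source.mem_nhds hy))).congr_of_eventuallyEq
    (eventuallyEq_comp_chartAt hy hf)

/-- The components of tangent vectors at `y` in the chart at `x₀`. -/
def toCoord (x₀ y : M) : TangentSpace 𝓘(ℝ, E) y →L[ℝ] E :=
  (trivializationAt E (TangentSpace 𝓘(ℝ, E)) x₀).continuousLinearMapAt ℝ y

/-- The tangent vector at `y` with given components in the chart at `x₀`. -/
def ofCoord (x₀ y : M) : E →L[ℝ] TangentSpace 𝓘(ℝ, E) y :=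
  (trivializationAt E (TangentSpace 𝓘(ℝ, E)) x₀).symmL ℝ y

section PointInSource

variable {x₀ y : M} (hy : y ∈ (chartAt E x₀).source)
include hy

lemma ofCoord_apply (u : E) :
    ofCoord x₀ y u = (trivializationAt E (TangentSpace 𝓘(ℝ, E)) x₀).symm y u :=
  Trivialization.symmL_apply _ hy _

lemma ofCoord_toCoord (v : TangentSpace 𝓘(ℝ, E) y) : ofCoord x₀ y (toCoord x₀ y v) = v :=
  (trivializationAt E (TangentSpace 𝓘(ℝ, E)) x₀).symmL_continuousLinearMapAt hy v

lemma toCoord_ofCoord (u : E) : toCoord x₀ y (ofCoord x₀ y u) = u :=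
  (trivializationAt E (TangentSpace 𝓘(ℝ, E)) x₀).continuousLinearMapAt_symmL hy u

lemma toCoord_injective : Function.Injective (toCoord (E := E) x₀ y) :=
  Function.LeftInverse.injective (ofCoord_toCoord hy)

lemma trivializationAt_snd (v : TangentSpace 𝓘(ℝ, E) y) :
    (trivializationAt E (TangentSpace 𝓘(ℝ, E)) x₀ ⟨y, v⟩).2 = toCoord x₀ y v := by
  rw [toCoord, Trivialization.continuousLinearMapAt_apply,
    Trivialization.coe_linearMapAt_of_mem _ hy]

lemma mfderiv_chartAt : mfderiv 𝓘(ℝ, E) 𝓘(ℝ, E) (chartAt E x₀) y = toCoord x₀ y := by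
  rw [toCoord, TangentBundle.continuousLinearMapAt_trivializationAt hy]
  simp only [mfld_simps]

lemma mvfderiv_eq_fderiv {f : M → F} {f' : E → F}
    (hf : f' =ᶠ[𝓝 (chartAt E x₀ y)] fun p ↦ f ((chartAt E x₀).symm p))
    (hd : DifferentiableAt ℝ f' (chartAt E x₀ y)) (v : TangentSpace 𝓘(ℝ, E) y) :
    mvfderiv 𝓘(ℝ, E) f y v = fderiv ℝ f' (chartAt E x₀ y) (toCoord x₀ y v) := by
  have hc : MDifferentiableAt 𝓘(ℝ, E) 𝓘(ℝ, E) (chartAt E x₀) y :=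
    mdifferentiableAt_atlas (chart_mem_atlas E x₀) hy
  have hderiv : mfderiv 𝓘(ℝ, E) 𝓘(ℝ, F) f y
      = (mfderiv 𝓘(ℝ, E) 𝓘(ℝ, F) f' (chartAt E x₀ y)).comp
        (mfderiv 𝓘(ℝ, E) 𝓘(ℝ, E) (chartAt E x₀) y) :=
    (eventuallyEq_comp_chartAt hy hf).mfderiv_eq.trans
      (mfderiv_comp y hd.mdifferentiableAt hc)
  rw [mfderiv_chartAt hy, mfderiv_eq_fderiv] at hderiv
  exact congrArg (fun L ↦ L v) hderiv

end PointInSource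

/-- A vector field read in the chart at `x₀`. -/
def coordRep (x₀ : M) (Y : VectorField E M) (p : E) : E :=
  toCoord x₀ ((chartAt E x₀).symm p) (Y ((chartAt E x₀).symm p))

lemma coordRep_chartAt {x₀ y : M} (hy : y ∈ (chartAt E x₀).source) (Y : VectorField E M) :
    coordRep x₀ Y (chartAt E x₀ y) = toCoord x₀ y (Y y) := by
  rw [coordRep, (chartAt E x₀).left_inv hy]

lemma coordRep_eventuallyEq {x₀ : M} {p : E} (hp : p ∈ (chartAt E x₀).target)
    (Y : VectorField E M) : coordRep x₀ Y =ᶠ[𝓝 p] fun p ↦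
      (fun y ↦ (trivializationAt E (TangentSpace 𝓘(ℝ, E)) x₀
        (Bundle.TotalSpace.mk' E y (Y y))).2) ((chartAt E x₀).symm p) := by
  filter_upwards [(chartAt E x₀).open_target.mem_nhds hp] with q hq
  exact (trivializationAt_snd ((chartAt E x₀).map_target hq) _).symm

/-- Smoothness of a vector field at a point. -/
abbrev SmoothAt (Y : VectorField E M) (y : M) : Prop :=
  ContMDiffAt 𝓘(ℝ, E) (𝓘(ℝ, E).prod 𝓘(ℝ, E)) ∞
    (fun x ↦ Bundle.TotalSpace.mk' E x (Y x) : M → TangentBundle 𝓘(ℝ, E) M) y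

lemma SmoothAt.contDiffAt_coordRep_of_mem_target {x₀ : M} {p : E}
    (hp : p ∈ (chartAt E x₀).target) {Y : VectorField E M}
    (h : SmoothAt Y ((chartAt E x₀).symm p)) : ContDiffAt ℝ ∞ (coordRep x₀ Y) p :=
  contDiffAt_of_contMDiffAt hp (coordRep_eventuallyEq hp Y)
    (((trivializationAt E (TangentSpace 𝓘(ℝ, E)) x₀).contMDiffAt_section_iff
      ((chartAt E x₀).map_target hp)).1 h)

lemma SmoothAt.contDiffAt_coordRep {x₀ y : M} (hy : y ∈ (chartAt E x₀).source)
    {Y : VectorField E M} (h : SmoothAt Y y) :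
    ContDiffAt ℝ ∞ (coordRep x₀ Y) (chartAt E x₀ y) :=
  SmoothAt.contDiffAt_coordRep_of_mem_target ((chartAt E x₀).map_source hy)
    (by rwa [(chartAt E x₀).left_inv hy])

lemma smoothAt_of_contDiffAt {x₀ y : M} (hy : y ∈ (chartAt E x₀).source) {Y : VectorField E M}
    (h : ContDiffAt ℝ ∞ (coordRep x₀ Y) (chartAt E x₀ y)) : SmoothAt Y y :=
  ((trivializationAt E (TangentSpace 𝓘(ℝ, E)) x₀).contMDiffAt_section_iff hy).2
    (contMDiffAt_of_contDiffAt hy (coordRep_eventuallyEq ((chartAt E x₀).map_source hy) Y) h)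

lemma smoothAt_ofCoord {x₀ y : M} (hy : y ∈ (chartAt E x₀).source) (u : E) :
    SmoothAt (fun z ↦ ofCoord x₀ z u) y := by
  refine smoothAt_of_contDiffAt hy (contDiffAt_const (c := u) |>.congr_of_eventuallyEq ?_)
  filter_upwards [(chartAt E x₀).open_target.mem_nhds ((chartAt E x₀).map_source hy)] with p hp
  exact toCoord_ofCoord ((chartAt E x₀).map_target hp) u

lemma localExt_self {x : M} (v : TangentSpace 𝓘(ℝ, E) x) : localExt v x = v :=
  FiberBundle.extend_apply_self E v

lemma localExt_eq_ofCoord {x y : M} (hy : y ∈ (chartAt E x).source)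
    (v : TangentSpace 𝓘(ℝ, E) x) : localExt v y = ofCoord x y (toCoord x x v) := by
  rw [ofCoord_apply hy, ← trivializationAt_snd (mem_chart_source E x), localExt,
    FiberBundle.extend]

lemma coordRep_localExt {x : M} (v : TangentSpace 𝓘(ℝ, E) x) {p : E}
    (hp : p ∈ (chartAt E x).target) : coordRep x (localExt v) p = toCoord x x v := by
  have hq := (chartAt E x).map_target hp
  rw [coordRep, localExt_eq_ofCoord hq, toCoord_ofCoord hq]

lemma coordRep_localExt_eventuallyEq {x y : M} (v : TangentSpace 𝓘(ℝ, E) x)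
    (hy : y ∈ (chartAt E x).source) :
    coordRep x (localExt v) =ᶠ[𝓝 (chartAt E x y)] fun _ ↦ toCoord x x v := by
  filter_upwards [(chartAt E x).open_target.mem_nhds ((chartAt E x).map_source hy)] with p hp
  exact coordRep_localExt v hp

lemma smoothAt_localExt {x y : M} (v : TangentSpace 𝓘(ℝ, E) x)
    (hy : y ∈ (chartAt E x).source) : SmoothAt (localExt v) y :=
  smoothAt_of_contDiffAt hy
    (contDiffAt_const.congr_of_eventuallyEq (coordRep_localExt_eventuallyEq v hy))

lemma eventually_smoothAt_localExt {x : M} (v : TangentSpace 𝓘(ℝ, E) x) :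
    ∀ᶠ z in 𝓝 x, SmoothAt (localExt v) z := by
  filter_upwards [(chartAt E x).open_source.mem_nhds (mem_chart_source E x)] with z hz
    using smoothAt_localExt v hz

end Coordinates

section LieBracket

variable {E : Type*} [NormedAddCommGroup E] [NormedSpace ℝ E]

lemma mlieBracket_eq_lieBracket (V W : Π p : E, TangentSpace 𝓘(ℝ, E) p) (p : E) :
    VectorField.mlieBracket 𝓘(ℝ, E) V W p = VectorField.lieBracket ℝ V W p := by
  rw [← VectorField.mlieBracketWithin_univ, VectorField.mlieBracketWithin_eq_lieBracketWithin]
  exact congrFun VectorField.lieBracketWithin_univ p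

variable {M : Type*} [TopologicalSpace M] [ChartedSpace E M] [IsManifold 𝓘(ℝ, E) ∞ M]

lemma mpullback_chartAt_symm {x₀ : M} {p : E} (hp : p ∈ (chartAt E x₀).target)
    (Z : VectorField E M) :
    VectorField.mpullback 𝓘(ℝ, E) 𝓘(ℝ, E) (chartAt E x₀).symm Z p = coordRep x₀ Z p := by
  have hq := (chartAt E x₀).map_target hp
  have hm := mdifferentiable_chart (I := 𝓘(ℝ, E)) x₀
  have hleft := hm.symm_comp_deriv hq
  have hright := hm.comp_symm_deriv hp
  rw [(chartAt E x₀).right_inv hp] at hleft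
  rw [VectorField.mpullback_apply, ContinuousLinearMap.inverse_eq hleft hright,
    mfderiv_chartAt hq]
  rfl

variable [CompleteSpace E]

lemma toCoord_mlieBracket {x₀ y : M} (hy : y ∈ (chartAt E x₀).source)
    {X Y : VectorField E M} (hX : SmoothAt X y) (hY : SmoothAt Y y) :
    toCoord x₀ y (VectorField.mlieBracket 𝓘(ℝ, E) X Y y)
      = fderiv ℝ (coordRep x₀ Y) (chartAt E x₀ y) (toCoord x₀ y (X y))
        - fderiv ℝ (coordRep x₀ X) (chartAt E x₀ y) (toCoord x₀ y (Y y)) := by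
  have hp := (chartAt E x₀).map_source hy
  have hdiff {Z : VectorField E M} (hZ : SmoothAt Z y) :
      MDifferentiableAt 𝓘(ℝ, E) 𝓘(ℝ, E).tangent (fun x ↦ Bundle.TotalSpace.mk' E x (Z x))
        ((chartAt E x₀).symm (chartAt E x₀ y)) := by
    rw [(chartAt E x₀).left_inv hy]
    exact hZ.mdifferentiableAt (by simp)
  have hpull (Z : VectorField E M) :
      VectorField.mpullback 𝓘(ℝ, E) 𝓘(ℝ, E) (chartAt E x₀).symm Z
        =ᶠ[𝓝 (chartAt E x₀ y)] coordRep x₀ Z := by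
    filter_upwards [(chartAt E x₀).open_target.mem_nhds hp] with p hp
    exact mpullback_chartAt_symm hp Z
  have : IsManifold 𝓘(ℝ, E) (minSmoothness ℝ 3) M := by
    rw [minSmoothness_of_isRCLikeNormedField]; infer_instance
  have hnat := VectorField.mpullback_mlieBracket (hdiff hX) (hdiff hY)
    (contMDiffOn_chart_symm.contMDiffAt ((chartAt E x₀).open_target.mem_nhds hp))
    (n := ∞) (by rw [minSmoothness_of_isRCLikeNormedField]; exact WithTop.coe_le_coe.2 le_top)
  rw [mpullback_chartAt_symm hp, coordRep_chartAt hy,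
    (hpull X).mlieBracket_vectorField_eq (hpull Y)] at hnat
  rw [hnat]
  refine (mlieBracket_eq_lieBracket _ _ _).trans ?_
  rw [VectorField.lieBracket, coordRep_chartAt hy, coordRep_chartAt hy]

lemma mlieBracket_localExt {x : M} (u v : TangentSpace 𝓘(ℝ, E) x) :
    VectorField.mlieBracket 𝓘(ℝ, E) (localExt u) (localExt v) x = 0 := by
  have hx := mem_chart_source E x
  refine toCoord_injective hx ?_
  rw [toCoord_mlieBracket hx (smoothAt_localExt u hx) (smoothAt_localExt v hx),
    (coordRep_localExt_eventuallyEq u hx).fderiv_eq,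
    (coordRep_localExt_eventuallyEq v hx).fderiv_eq]
  simp

end LieBracket

section BilinearMaps

variable {E F G : Type*} [NormedAddCommGroup E] [NormedSpace ℝ E] [NormedAddCommGroup F]
  [NormedSpace ℝ F] [NormedAddCommGroup G] [NormedSpace ℝ G]

-- Shortcuts: without them, instance synthesis exceeds its limits on these spaces.
instance instNormedAddCommGroupBilin : NormedAddCommGroup (E →L[ℝ] F →L[ℝ] G) :=
  ContinuousLinearMap.toNormedAddCommGroup

instance instNormedSpaceBilin : NormedSpace ℝ (E →L[ℝ] F →L[ℝ] G) :=
  ContinuousLinearMap.toNormedSpace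

end BilinearMaps

section Christoffel

variable {E : Type*} [NormedAddCommGroup E] [NormedSpace ℝ E]

/-- The Christoffel symbols of the first kind of a metric `G` on an open subset of `E`. -/
def christoffelLower (G : E → E →L[ℝ] E →L[ℝ] ℝ) (p u v : E) : E →L[ℝ] ℝ :=
  (1 / 2 : ℝ) • (fderiv ℝ G p u v + fderiv ℝ G p v u - ((fderiv ℝ G p).flip u).flip v)

lemma christoffelLower_apply (G : E → E →L[ℝ] E →L[ℝ] ℝ) (p u v w : E) :
    christoffelLower G p u v w
      = (1 / 2) * (fderiv ℝ G p u v w + fderiv ℝ G p v u w - fderiv ℝ G p w u v) := by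
  simp [christoffelLower]

variable [FiniteDimensional ℝ E]

/-- The Christoffel symbols of a metric `G` on an open subset of `E`, as a bilinear map; the index
is raised with the inverse of `G`, which is `0` where `G` is degenerate. -/
def christoffel (G : E → E →L[ℝ] E →L[ℝ] ℝ) (p : E) : E →L[ℝ] E →L[ℝ] E :=
  (LinearMap.mk₂ ℝ (fun u v ↦ (G p).inverse (christoffelLower G p u v))
    (fun u u' v ↦ by rw [← map_add]; congr 1; ext w; simp [christoffelLower_apply]; ring)
    (fun c u v ↦ by rw [← map_smul]; congr 1; ext w; simp [christoffelLower_apply]; ring)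
    (fun u v v' ↦ by rw [← map_add]; congr 1; ext w; simp [christoffelLower_apply]; ring)
    (fun c u v ↦ by rw [← map_smul]; congr 1; ext w; simp [christoffelLower_apply]; ring)
    ).toContinuousBilinearMap

lemma christoffel_apply (G : E → E →L[ℝ] E →L[ℝ] ℝ) (p u v : E) :
    christoffel G p u v = (G p).inverse (christoffelLower G p u v) := rfl

lemma metric_christoffel {G : E → E →L[ℝ] E →L[ℝ] ℝ} {p : E} (hG : (G p).IsInvertible)
    (u v w : E) : G p (christoffel G p u v) w = christoffelLower G p u v w := by
  obtain ⟨e, he⟩ := hG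
  simp [christoffel_apply, ← he]

lemma contDiffOn_christoffel {G : E → E →L[ℝ] E →L[ℝ] ℝ} {s : Set E} (hs : IsOpen s)
    (hG : ∀ p ∈ s, (G p).IsInvertible) (h : ContDiffOn ℝ ∞ G s) :
    ContDiffOn ℝ ∞ (christoffel G) s := by
  have hfderiv (u v w : E) : ContDiffOn ℝ ∞ (fun p ↦ fderiv ℝ G p u v w) s :=
    (((h.fderiv_of_isOpen hs (by simp)).clm_apply contDiffOn_const).clm_apply
      contDiffOn_const).clm_apply contDiffOn_const
  have hinverse : ContDiffOn ℝ ∞ (fun p ↦ (G p).inverse) s := fun p hp ↦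
    (hG p hp).contDiffAt_map_inverse.comp_contDiffWithinAt p (h p hp)
  refine contDiffOn_clm_apply.2 fun u ↦ contDiffOn_clm_apply.2 fun v ↦ ?_
  simp_rw [christoffel_apply]
  refine hinverse.clm_apply (contDiffOn_clm_apply.2 fun w ↦ ?_)
  simp_rw [christoffelLower_apply]
  exact contDiffOn_const.mul (((hfderiv u v w).add (hfderiv v u w)).sub (hfderiv w u v))

end Christoffel

section LeviCivita

variable {E : Type*} [NormedAddCommGroup E] [NormedSpace ℝ E]
  {M : Type*} [TopologicalSpace M] [ChartedSpace E M] [IsManifold 𝓘(ℝ, E) ∞ M]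
  [RiemannianBundle (fun x : M ↦ TangentSpace 𝓘(ℝ, E) x)]

/-- The metric read in the chart at `x₀`. -/
def metricCoord (x₀ : M) (p : E) : E →L[ℝ] E →L[ℝ] ℝ :=
  (innerSL ℝ).bilinearComp (ofCoord x₀ ((chartAt E x₀).symm p))
    (ofCoord x₀ ((chartAt E x₀).symm p))

lemma metricCoord_apply (x₀ : M) (p u v : E) : metricCoord x₀ p u v
    = inner ℝ (ofCoord x₀ ((chartAt E x₀).symm p) u) (ofCoord x₀ ((chartAt E x₀).symm p) v) := rfl

lemma metricCoord_comm (x₀ : M) (p u v : E) : metricCoord x₀ p u v = metricCoord x₀ p v u := by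
  rw [metricCoord_apply, metricCoord_apply, real_inner_comm]

lemma metricCoord_toCoord {x₀ y : M} (hy : y ∈ (chartAt E x₀).source)
    (v w : TangentSpace 𝓘(ℝ, E) y) :
    metricCoord x₀ (chartAt E x₀ y) (toCoord x₀ y v) (toCoord x₀ y w) = inner ℝ v w := by
  rw [metricCoord_apply, (chartAt E x₀).left_inv hy, ofCoord_toCoord hy, ofCoord_toCoord hy]

variable [FiniteDimensional ℝ E]

lemma isInvertible_metricCoord {x₀ : M} {p : E} (hp : p ∈ (chartAt E x₀).target) :
    (metricCoord x₀ p).IsInvertible := by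
  have hinj : Function.Injective (metricCoord x₀ p).toLinearMap := by
    rw [← LinearMap.ker_eq_bot, LinearMap.ker_eq_bot']
    intro u hu
    have hself : inner ℝ (ofCoord x₀ ((chartAt E x₀).symm p) u)
        (ofCoord x₀ ((chartAt E x₀).symm p) u) = (0 : ℝ) :=
      congrArg (fun f : E →L[ℝ] ℝ ↦ f u) hu
    rw [← toCoord_ofCoord ((chartAt E x₀).map_target hp) u, inner_self_eq_zero.1 hself, map_zero]
  have hdim : Module.finrank ℝ E = Module.finrank ℝ (E →L[ℝ] ℝ) := by
    rw [← (LinearMap.toContinuousLinearMap (𝕜 := ℝ) (E := E) (F' := ℝ)).finrank_eq]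
    exact Subspace.dual_finrank_eq.symm
  exact ⟨(LinearEquiv.ofInjectiveOfFinrankEq _ hinj hdim).toContinuousLinearEquiv, by ext; rfl⟩

/-- The Christoffel symbols in the chart at `x₀`. -/
def chr (x₀ : M) : E → E →L[ℝ] E →L[ℝ] E := christoffel (metricCoord x₀)

lemma metricCoord_chr {x₀ : M} {p : E} (hp : p ∈ (chartAt E x₀).target) (u v w : E) :
    metricCoord x₀ p (chr x₀ p u v) w = (1 / 2) * (fderiv ℝ (metricCoord x₀) p u v w
      + fderiv ℝ (metricCoord x₀) p v u w - fderiv ℝ (metricCoord x₀) p w u v) := by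
  rw [chr, metric_christoffel (isInvertible_metricCoord hp), christoffelLower_apply]

variable [IsContMDiffRiemannianBundle 𝓘(ℝ, E) ∞ E (fun x : M ↦ TangentSpace 𝓘(ℝ, E) x)]

lemma contDiffOn_metricCoord (x₀ : M) :
    ContDiffOn ℝ ∞ (metricCoord (E := E) x₀) (chartAt E x₀).target := by
  refine contDiffOn_clm_apply.2 fun u ↦ contDiffOn_clm_apply.2 fun v p hp ↦ ?_
  have hq := (chartAt E x₀).map_target hp
  have h : ContMDiffAt 𝓘(ℝ, E) 𝓘(ℝ, ℝ) ∞
      (fun z : M ↦ inner ℝ (ofCoord x₀ z u) (ofCoord x₀ z v)) ((chartAt E x₀).symm p) :=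
    ContMDiffAt.inner_bundle (F := E) (E := fun x : M ↦ TangentSpace 𝓘(ℝ, E) x) (b := id)
      (smoothAt_ofCoord hq u) (smoothAt_ofCoord hq v)
  exact (contDiffAt_of_contMDiffAt hp (Filter.EventuallyEq.refl _ _) h).contDiffWithinAt

lemma differentiableAt_metricCoord {x₀ : M} {p : E} (hp : p ∈ (chartAt E x₀).target) :
    DifferentiableAt ℝ (metricCoord (E := E) x₀) p :=
  ((contDiffOn_metricCoord x₀).contDiffAt
    ((chartAt E x₀).open_target.mem_nhds hp)).differentiableAt (by simp)

lemma contDiffAt_chr {x₀ : M} {p : E} (hp : p ∈ (chartAt E x₀).target) :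
    ContDiffAt ℝ ∞ (chr (E := E) x₀) p :=
  (contDiffOn_christoffel (chartAt E x₀).open_target (fun _ ↦ isInvertible_metricCoord)
    (contDiffOn_metricCoord x₀)).contDiffAt ((chartAt E x₀).open_target.mem_nhds hp)

lemma fderiv_metricCoord_comm {x₀ : M} {p : E} (hp : p ∈ (chartAt E x₀).target) (u v w : E) :
    fderiv ℝ (metricCoord x₀) p u v w = fderiv ℝ (metricCoord x₀) p u w v := by
  have hd := differentiableAt_metricCoord hp
  have hpair (a b : E) : fderiv ℝ (metricCoord x₀) p u a b
      = fderiv ℝ (fun p ↦ metricCoord x₀ p a b) p u := by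
    rw [fderiv_clm_apply (by fun_prop) (by fun_prop), fderiv_clm_apply (by fun_prop) (by fun_prop)]
    simp
  rw [hpair, hpair]
  simp_rw [metricCoord_comm x₀ _ v w]

lemma chr_comm {x₀ : M} {p : E} (hp : p ∈ (chartAt E x₀).target) (u v : E) :
    chr x₀ p u v = chr x₀ p v u := by
  obtain ⟨e, he⟩ := isInvertible_metricCoord (x₀ := x₀) hp
  refine e.injective (ContinuousLinearMap.ext fun w ↦ ?_)
  have huv := metricCoord_chr (x₀ := x₀) hp u v w
  have hvu := metricCoord_chr (x₀ := x₀) hp v u w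
  rw [← he, ContinuousLinearEquiv.coe_coe] at huv hvu
  rw [huv, hvu, fderiv_metricCoord_comm hp w u v]
  ring

lemma fderiv_metricCoord {x₀ : M} {p : E} (hp : p ∈ (chartAt E x₀).target) (u v w : E) :
    fderiv ℝ (metricCoord x₀) p u v w
      = metricCoord x₀ p (chr x₀ p u v) w + metricCoord x₀ p v (chr x₀ p u w) := by
  rw [metricCoord_comm x₀ p v, metricCoord_chr hp, metricCoord_chr hp,
    fderiv_metricCoord_comm hp w u v, fderiv_metricCoord_comm hp v u w,
    fderiv_metricCoord_comm hp u w v]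
  ring

lemma mvfderiv_inner_eq_metricCoord {x₀ y : M} (hy : y ∈ (chartAt E x₀).source)
    {V W : VectorField E M} (hV : SmoothAt V y) (hW : SmoothAt W y)
    (v : TangentSpace 𝓘(ℝ, E) y) :
    mvfderiv 𝓘(ℝ, E) (fun y ↦ inner ℝ (V y) (W y)) y v
      = fderiv ℝ (metricCoord x₀) (chartAt E x₀ y) (toCoord x₀ y v) (toCoord x₀ y (V y))
          (toCoord x₀ y (W y))
        + metricCoord x₀ (chartAt E x₀ y)
          (fderiv ℝ (coordRep x₀ V) (chartAt E x₀ y) (toCoord x₀ y v)) (toCoord x₀ y (W y))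
        + metricCoord x₀ (chartAt E x₀ y) (toCoord x₀ y (V y))
          (fderiv ℝ (coordRep x₀ W) (chartAt E x₀ y) (toCoord x₀ y v)) := by
  have hp := (chartAt E x₀).map_source hy
  have hG := differentiableAt_metricCoord hp
  have hV' := (hV.contDiffAt_coordRep hy).differentiableAt (by simp)
  have hW' := (hW.contDiffAt_coordRep hy).differentiableAt (by simp)
  rw [mvfderiv_eq_fderiv hy (f' := fun p ↦ metricCoord x₀ p (coordRep x₀ V p) (coordRep x₀ W p))
    _ (by fun_prop)]
  · rw [fderiv_clm_apply (by fun_prop) (by fun_prop), fderiv_clm_apply (by fun_prop) (by fun_prop)]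
    simp only [_root_.add_apply, ContinuousLinearMap.comp_apply,
      ContinuousLinearMap.flip_apply, coordRep_chartAt hy]
    ring
  · filter_upwards [(chartAt E x₀).open_target.mem_nhds hp] with p hp
    have hq := (chartAt E x₀).map_target hp
    rw [metricCoord_apply, coordRep, coordRep, ofCoord_toCoord hq, ofCoord_toCoord hq]

lemma koszul_eq_metricCoord {x₀ y : M} (hy : y ∈ (chartAt E x₀).source) {X Y Z : VectorField E M}
    (hX : SmoothAt X y) (hY : SmoothAt Y y) (hZ : SmoothAt Z y) :
    koszul X Y Z y = metricCoord x₀ (chartAt E x₀ y)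
      (fderiv ℝ (coordRep x₀ Y) (chartAt E x₀ y) (toCoord x₀ y (X y))
        + chr x₀ (chartAt E x₀ y) (toCoord x₀ y (X y)) (toCoord x₀ y (Y y)))
      (toCoord x₀ y (Z y)) := by
  have hp := (chartAt E x₀).map_source hy
  rw [koszul, mvfderiv_inner_eq_metricCoord hy hY hZ, mvfderiv_inner_eq_metricCoord hy hX hZ,
    mvfderiv_inner_eq_metricCoord hy hX hY, map_add, _root_.add_apply, metricCoord_chr hp,
    ← metricCoord_toCoord hy, ← metricCoord_toCoord hy, ← metricCoord_toCoord hy,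
    toCoord_mlieBracket hy hX hY, toCoord_mlieBracket hy hX hZ, toCoord_mlieBracket hy hY hZ]
  simp only [map_sub, _root_.sub_apply]
  rw [metricCoord_comm x₀ _ (toCoord x₀ y (Y y)) (fderiv ℝ (coordRep x₀ Z) _ _),
    metricCoord_comm x₀ _ (toCoord x₀ y (X y)) (fderiv ℝ (coordRep x₀ Z) _ _),
    metricCoord_comm x₀ _ (toCoord x₀ y (X y)) (fderiv ℝ (coordRep x₀ Y) _ _)]
  ring

theorem toCoord_nabla {x₀ y : M} (hy : y ∈ (chartAt E x₀).source) {Y : VectorField E M}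
    (hY : SmoothAt Y y) (v : TangentSpace 𝓘(ℝ, E) y) :
    toCoord x₀ y (nabla Y y v) = fderiv ℝ (coordRep x₀ Y) (chartAt E x₀ y) (toCoord x₀ y v)
      + chr x₀ (chartAt E x₀ y) (toCoord x₀ y v) (toCoord x₀ y (Y y)) := by
  set ξ := fderiv ℝ (coordRep x₀ Y) (chartAt E x₀ y) (toCoord x₀ y v)
    + chr x₀ (chartAt E x₀ y) (toCoord x₀ y v) (toCoord x₀ y (Y y)) with hξ
  have hs := mem_chart_source E y
  have hkoszul (i) : koszul (localExt v) Y (localExt (onb y i)) y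
      = inner ℝ (onb y i) (ofCoord x₀ y ξ) := by
    rw [koszul_eq_metricCoord hy (smoothAt_localExt v hs) hY (smoothAt_localExt _ hs),
      localExt_self, localExt_self, ← hξ, real_inner_comm, ← metricCoord_toCoord hy,
      toCoord_ofCoord hy]
  rw [nabla]
  simp_rw [hkoszul]
  rw [OrthonormalBasis.sum_repr', toCoord_ofCoord hy]

lemma mvfderiv_inner {y : M} {V W : VectorField E M} (hV : SmoothAt V y) (hW : SmoothAt W y)
    (v : TangentSpace 𝓘(ℝ, E) y) :
    mvfderiv 𝓘(ℝ, E) (fun y ↦ inner ℝ (V y) (W y)) y v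
      = inner ℝ (nabla V y v) (W y) + inner ℝ (V y) (nabla W y v) := by
  have hy := mem_chart_source E y
  rw [mvfderiv_inner_eq_metricCoord hy hV hW, ← metricCoord_toCoord hy, ← metricCoord_toCoord hy,
    toCoord_nabla hy hV, toCoord_nabla hy hW, fderiv_metricCoord ((chartAt E y).map_source hy)]
  simp only [map_add, _root_.add_apply]
  ring

lemma toCoord_nabla_localExt {x : M} (u v : TangentSpace 𝓘(ℝ, E) x) :
    toCoord x x (nabla (localExt v) x u)
      = chr x (chartAt E x x) (toCoord x x u) (toCoord x x v) := by
  have hx := mem_chart_source E x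
  rw [toCoord_nabla hx (smoothAt_localExt v hx),
    (coordRep_localExt_eventuallyEq v hx).fderiv_eq, localExt_self]
  simp

lemma nabla_localExt_comm {x : M} (u v : TangentSpace 𝓘(ℝ, E) x) :
    nabla (localExt v) x u = nabla (localExt u) x v := by
  have hx := mem_chart_source E x
  refine toCoord_injective hx ?_
  rw [toCoord_nabla_localExt, toCoord_nabla_localExt, chr_comm ((chartAt E x).map_source hx)]

end LeviCivita

section MapCoord

variable {H M K N : Type*} [TopologicalSpace H] [TopologicalSpace M] [ChartedSpace H M]
  [TopologicalSpace K] [TopologicalSpace N] [ChartedSpace K N]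

/-- A map read in the charts at `x₀` and `q₀`. -/
def mapCoord (x₀ : M) (q₀ : N) (φ : M → N) (p : H) : K :=
  chartAt K q₀ (φ ((chartAt H x₀).symm p))

lemma mapCoord_chartAt {x₀ y : M} (hy : y ∈ (chartAt H x₀).source) (q₀ : N) (φ : M → N) :
    mapCoord x₀ q₀ φ (chartAt H x₀ y) = chartAt K q₀ (φ y) := by
  rw [mapCoord, (chartAt H x₀).left_inv hy]

end MapCoord

section SectionsAlong

variable {E : Type*} [NormedAddCommGroup E] {M : Type*} [TopologicalSpace M] [ChartedSpace E M]
  {F : Type*} [NormedAddCommGroup F] [NormedSpace ℝ F]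
  {N : Type*} [TopologicalSpace N] [ChartedSpace F N] [IsManifold 𝓘(ℝ, F) ∞ N]
  {φ : M → N} {V : Π x : M, TangentSpace 𝓘(ℝ, F) (φ x)} {x₀ y : M} {q₀ : N}

/-- A section of `φ⁻¹TN` read in the charts at `x₀` and `q₀`. -/
def alongRep (x₀ : M) (q₀ : N) (φ : M → N) (V : Π x : M, TangentSpace 𝓘(ℝ, F) (φ x)) (p : E) : F :=
  toCoord q₀ (φ ((chartAt E x₀).symm p)) (V ((chartAt E x₀).symm p))

lemma alongRep_chartAt (hy : y ∈ (chartAt E x₀).source) (q₀ : N) (φ : M → N)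
    (V : Π x : M, TangentSpace 𝓘(ℝ, F) (φ x)) :
    alongRep x₀ q₀ φ V (chartAt E x₀ y) = toCoord q₀ (φ y) (V y) := by
  rw [alongRep, (chartAt E x₀).left_inv hy]

lemma alongRep_eventuallyEq (hy : y ∈ (chartAt E x₀).source) (hy' : φ y ∈ (chartAt F q₀).source)
    (hφ : ContinuousAt φ y) (V : Π x : M, TangentSpace 𝓘(ℝ, F) (φ x)) :
    alongRep x₀ q₀ φ V =ᶠ[𝓝 (chartAt E x₀ y)] fun p ↦
      (fun z ↦ (trivializationAt F (TangentSpace 𝓘(ℝ, F) : N → Type _) q₀ ⟨φ z, V z⟩).2)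
        ((chartAt E x₀).symm p) := by
  rw [eventuallyEq_nhds_chartAt hy]
  filter_upwards [(chartAt E x₀).open_source.mem_nhds hy,
    hφ ((chartAt F q₀).open_source.mem_nhds hy')] with z hz hz'
  simp only [Function.comp_apply]
  rw [alongRep, trivializationAt_snd (by rwa [(chartAt E x₀).left_inv hz])]

variable [NormedSpace ℝ E]

variable (E) in
/-- Smoothness at a point of a section of `φ⁻¹TN`, as a map from `M` to `TN`. -/
abbrev SmoothAlongAt (φ : M → N) (V : Π x : M, TangentSpace 𝓘(ℝ, F) (φ x)) (y : M) : Prop :=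
  ContMDiffAt 𝓘(ℝ, E) (𝓘(ℝ, F).prod 𝓘(ℝ, F)) ∞
    (fun x ↦ Bundle.TotalSpace.mk' F (φ x) (V x) : M → TangentBundle 𝓘(ℝ, F) N) y

lemma smoothAlongAt_iff (hy' : φ y ∈ (chartAt F q₀).source) :
    SmoothAlongAt E φ V y ↔ ContMDiffAt 𝓘(ℝ, E) 𝓘(ℝ, F) ∞ φ y ∧ ContMDiffAt 𝓘(ℝ, E) 𝓘(ℝ, F) ∞
      (fun z ↦ (trivializationAt F (TangentSpace 𝓘(ℝ, F) : N → Type _) q₀ ⟨φ z, V z⟩).2) y :=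
  have hsource : (⟨φ y, V y⟩ : TangentBundle 𝓘(ℝ, F) N)
      ∈ (trivializationAt F (TangentSpace 𝓘(ℝ, F)) q₀).source :=
    (trivializationAt F (TangentSpace 𝓘(ℝ, F)) q₀).mem_source.2 hy'
  (trivializationAt F (TangentSpace 𝓘(ℝ, F)) q₀).contMDiffAt_iff hsource

lemma SmoothAlongAt.contMDiffAt (h : SmoothAlongAt E φ V y) :
    ContMDiffAt 𝓘(ℝ, E) 𝓘(ℝ, F) ∞ φ y :=
  (contMDiffAt_totalSpace.1 h).1

lemma SmoothAlongAt.congr {W : Π x : M, TangentSpace 𝓘(ℝ, F) (φ x)} (h : SmoothAlongAt E φ V y)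
    (hVW : ∀ᶠ z in 𝓝 y, W z = V z) : SmoothAlongAt E φ W y :=
  ContMDiffAt.congr_of_eventuallyEq h
    (hVW.mono fun z hz ↦ congrArg (Bundle.TotalSpace.mk' F (φ z)) hz)

lemma SmoothAt.comp {W : VectorField F N} (hW : SmoothAt W (φ y))
    (hφ : ContMDiffAt 𝓘(ℝ, E) 𝓘(ℝ, F) ∞ φ y) : SmoothAlongAt E φ (fun z ↦ W (φ z)) y :=
  ContMDiffAt.comp y hW hφ

variable [IsManifold 𝓘(ℝ, E) ∞ M]

lemma SmoothAt.smoothAlongAt_dmap {Y : VectorField E M} (hY : SmoothAt Y y)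
    (hφ : ContMDiff 𝓘(ℝ, E) 𝓘(ℝ, F) ∞ φ) :
    SmoothAlongAt E φ (fun z ↦ dmap E F φ z (Y z)) y :=
  (hφ.contMDiff_tangentMap (m := ∞) (by simp)).contMDiffAt.comp y hY

section Charts

variable (hy : y ∈ (chartAt E x₀).source) (hy' : φ y ∈ (chartAt F q₀).source)
include hy hy'

lemma contDiffAt_mapCoord (hφ : ContMDiffAt 𝓘(ℝ, E) 𝓘(ℝ, F) ∞ φ y) :
    ContDiffAt ℝ ∞ (mapCoord (K := F) x₀ q₀ φ) (chartAt E x₀ y) := by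
  refine contDiffAt_of_contMDiffAt (f := chartAt F q₀ ∘ φ) ((chartAt E x₀).map_source hy)
    (Filter.EventuallyEq.refl _ _) ?_
  rw [(chartAt E x₀).left_inv hy]
  exact (contMDiffOn_chart.contMDiffAt ((chartAt F q₀).open_source.mem_nhds hy')).comp y hφ

lemma toCoord_dmap (hφ : ContMDiffAt 𝓘(ℝ, E) 𝓘(ℝ, F) ∞ φ y) (v : TangentSpace 𝓘(ℝ, E) y) :
    toCoord q₀ (φ y) (dmap E F φ y v)
      = fderiv ℝ (mapCoord x₀ q₀ φ) (chartAt E x₀ y) (toCoord x₀ y v) := by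
  have hchart : MDifferentiableAt 𝓘(ℝ, F) 𝓘(ℝ, F) (chartAt F q₀) (φ y) :=
    mdifferentiableAt_atlas (chart_mem_atlas F q₀) hy'
  have hcomp : mfderiv 𝓘(ℝ, E) 𝓘(ℝ, F) (chartAt F q₀ ∘ φ) y
      = (mfderiv 𝓘(ℝ, F) 𝓘(ℝ, F) (chartAt F q₀) (φ y)).comp (dmap E F φ y) :=
    mfderiv_comp y hchart (hφ.mdifferentiableAt (by simp))
  rw [mfderiv_chartAt hy'] at hcomp
  rw [← mvfderiv_eq_fderiv hy (f := chartAt F q₀ ∘ φ) (f' := mapCoord x₀ q₀ φ)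
    (Filter.EventuallyEq.refl _ _)
    ((contDiffAt_mapCoord hy hy' hφ).differentiableAt (by simp)) v]
  exact congrArg (fun L ↦ L v) hcomp.symm

lemma SmoothAlongAt.contDiffAt_alongRep (h : SmoothAlongAt E φ V y) :
    ContDiffAt ℝ ∞ (alongRep x₀ q₀ φ V) (chartAt E x₀ y) := by
  refine contDiffAt_of_contMDiffAt
    (f := fun z ↦ (trivializationAt F (TangentSpace 𝓘(ℝ, F) : N → Type _) q₀ ⟨φ z, V z⟩).2)
    ((chartAt E x₀).map_source hy)
    (alongRep_eventuallyEq hy hy' h.contMDiffAt.continuousAt V) ?_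
  rw [(chartAt E x₀).left_inv hy]
  exact ((smoothAlongAt_iff hy').1 h).2

lemma smoothAlongAt_of_contDiffAt (hφ : ContMDiffAt 𝓘(ℝ, E) 𝓘(ℝ, F) ∞ φ y)
    (h : ContDiffAt ℝ ∞ (alongRep x₀ q₀ φ V) (chartAt E x₀ y)) : SmoothAlongAt E φ V y :=
  (smoothAlongAt_iff hy').2
    ⟨hφ, contMDiffAt_of_contDiffAt hy (alongRep_eventuallyEq hy hy' hφ.continuousAt V) h⟩

end Charts

section Algebra

variable {V W : Π x : M, TangentSpace 𝓘(ℝ, F) (φ x)}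

lemma SmoothAlongAt.add (hV : SmoothAlongAt E φ V y) (hW : SmoothAlongAt E φ W y) :
    SmoothAlongAt E φ (fun z ↦ V z + W z) y := by
  have hy := mem_chart_source E y
  have hy' := mem_chart_source F (φ y)
  refine smoothAlongAt_of_contDiffAt hy hy' hV.contMDiffAt ?_
  refine ((hV.contDiffAt_alongRep hy hy').add (hW.contDiffAt_alongRep hy hy')).congr_of_eventuallyEq
    (Filter.Eventually.of_forall fun p ↦ ?_)
  exact map_add _ _ _

lemma SmoothAlongAt.const_smul (hV : SmoothAlongAt E φ V y) (c : ℝ) :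
    SmoothAlongAt E φ (fun z ↦ c • V z) y := by
  have hy := mem_chart_source E y
  have hy' := mem_chart_source F (φ y)
  refine smoothAlongAt_of_contDiffAt hy hy' hV.contMDiffAt ?_
  refine ((hV.contDiffAt_alongRep hy hy').const_smul c).congr_of_eventuallyEq
    (Filter.Eventually.of_forall fun p ↦ ?_)
  exact map_smul _ _ _

end Algebra

end SectionsAlong

section ChartChange

variable {F : Type*} [NormedAddCommGroup F] [NormedSpace ℝ F]
  {N : Type*} [TopologicalSpace N] [ChartedSpace F N] [IsManifold 𝓘(ℝ, F) ∞ N]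

/-- The change of components of tangent vectors from the chart at `q` to the chart at `q₀`, as a
function of the coordinates of the base point in the chart at `q₀`. -/
def transCoord (q₀ q : N) (r : F) : F →L[ℝ] F :=
  (toCoord q₀ ((chartAt F q₀).symm r)).comp (ofCoord q ((chartAt F q₀).symm r))

variable {q₀ q w : N} (hw₀ : w ∈ (chartAt F q₀).source)
include hw₀

lemma transCoord_chartAt (q : N) (u : F) :
    transCoord q₀ q (chartAt F q₀ w) u = toCoord q₀ w (ofCoord q w u) := by
  rw [transCoord, (chartAt F q₀).left_inv hw₀, ContinuousLinearMap.comp_apply]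

variable (hw : w ∈ (chartAt F q).source)
include hw

lemma transCoord_toCoord (v : TangentSpace 𝓘(ℝ, F) w) :
    transCoord q₀ q (chartAt F q₀ w) (toCoord q w v) = toCoord q₀ w v := by
  rw [transCoord_chartAt hw₀, ofCoord_toCoord hw]

lemma differentiableAt_transCoord [FiniteDimensional ℝ F] :
    DifferentiableAt ℝ (transCoord (F := F) q₀ q) (chartAt F q₀ w) := by
  have hs := (chartAt F q₀).isOpen_inter_preimage_symm (chartAt F q).open_source
  have hws : chartAt F q₀ w ∈
      (chartAt F q₀).target ∩ (chartAt F q₀).symm ⁻¹' (chartAt F q).source :=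
    ⟨(chartAt F q₀).map_source hw₀, by rwa [Set.mem_preimage, (chartAt F q₀).left_inv hw₀]⟩
  have h : ContDiffOn ℝ ∞ (transCoord (F := F) q₀ q)
      ((chartAt F q₀).target ∩ (chartAt F q₀).symm ⁻¹' (chartAt F q).source) :=
    contDiffOn_clm_apply.2 fun u r hr ↦
      ((smoothAt_ofCoord hr.2 u).contDiffAt_coordRep_of_mem_target hr.1).contDiffWithinAt
  exact (h.contDiffAt (hs.mem_nhds hws)).differentiableAt (by simp)

lemma coordRep_localExt_eventuallyEq_transCoord (v : TangentSpace 𝓘(ℝ, F) q) :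
    coordRep q₀ (localExt v) =ᶠ[𝓝 (chartAt F q₀ w)] fun r ↦ transCoord q₀ q r (toCoord q q v) := by
  rw [eventuallyEq_nhds_chartAt hw₀]
  filter_upwards [(chartAt F q₀).open_source.mem_nhds hw₀,
    (chartAt F q).open_source.mem_nhds hw] with z hz₀ hz
  simp only [Function.comp_apply]
  rw [coordRep_chartAt hz₀, transCoord_chartAt hz₀, localExt_eq_ofCoord hz]

end ChartChange

section Along

variable {E : Type*} [NormedAddCommGroup E] [NormedSpace ℝ E]
  {M : Type*} [TopologicalSpace M] [ChartedSpace E M] [IsManifold 𝓘(ℝ, E) ∞ M]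
  {F : Type*} [NormedAddCommGroup F] [NormedSpace ℝ F] [FiniteDimensional ℝ F]
  {N : Type*} [TopologicalSpace N] [ChartedSpace F N] [IsManifold 𝓘(ℝ, F) ∞ N]
  {φ : M → N} {V W : Π x : M, TangentSpace 𝓘(ℝ, F) (φ x)} {x₀ y : M} {q₀ q : N}

lemma fderiv_alongRep (hy : y ∈ (chartAt E x₀).source) (hy₀ : φ y ∈ (chartAt F q₀).source)
    (hyq : φ y ∈ (chartAt F q).source) (hV : SmoothAlongAt E φ V y) (u : E) :
    fderiv ℝ (alongRep x₀ q₀ φ V) (chartAt E x₀ y) u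
      = transCoord q₀ q (chartAt F q₀ (φ y)) (fderiv ℝ (alongRep x₀ q φ V) (chartAt E x₀ y) u)
        + fderiv ℝ (transCoord q₀ q) (chartAt F q₀ (φ y))
          (fderiv ℝ (mapCoord x₀ q₀ φ) (chartAt E x₀ y) u) (toCoord q (φ y) (V y)) := by
  have hφ := hV.contMDiffAt
  have htrans : alongRep x₀ q₀ φ V =ᶠ[𝓝 (chartAt E x₀ y)]
      fun p ↦ transCoord q₀ q (mapCoord x₀ q₀ φ p) (alongRep x₀ q φ V p) := by
    rw [eventuallyEq_nhds_chartAt hy]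
    filter_upwards [(chartAt E x₀).open_source.mem_nhds hy,
      hφ.continuousAt ((chartAt F q₀).open_source.mem_nhds hy₀),
      hφ.continuousAt ((chartAt F q).open_source.mem_nhds hyq)] with z hz hz₀ hzq
    simp only [Function.comp_apply]
    rw [alongRep_chartAt hz, alongRep_chartAt hz, mapCoord_chartAt hz, transCoord_toCoord hz₀ hzq]
  have hmap := ((contDiffAt_mapCoord hy hy₀ hφ).differentiableAt (by simp)).hasFDerivAt
  have hT := (differentiableAt_transCoord hy₀ hyq).hasFDerivAt
  have hV' := ((hV.contDiffAt_alongRep hy hyq).differentiableAt (by simp)).hasFDerivAt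
  rw [← mapCoord_chartAt hy] at hT
  rw [(((hT.comp _ hmap).clm_apply hV').congr_of_eventuallyEq htrans).fderiv,
    Function.comp_apply, mapCoord_chartAt hy, alongRep_chartAt hy]
  simp

variable [RiemannianBundle (fun p : N ↦ TangentSpace 𝓘(ℝ, F) p)]

lemma nablaAlong_eq_fderiv (hy : y ∈ (chartAt E x₀).source) (hV : SmoothAlongAt E φ V y)
    (v : TangentSpace 𝓘(ℝ, E) y) :
    nablaAlong φ V y v
      = ofCoord (φ y) (φ y)
          (fderiv ℝ (alongRep x₀ (φ y) φ V) (chartAt E x₀ y) (toCoord x₀ y v))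
        + nabla (localExt (V y)) (φ y) (dmap E F φ y v) := by
  have hφy := mem_chart_source F (φ y)
  rw [nablaAlong, mvfderiv_eq_fderiv hy
    (alongRep_eventuallyEq hy hφy hV.contMDiffAt.continuousAt V)
    ((hV.contDiffAt_alongRep hy hφy).differentiableAt (by simp)), ofCoord_apply hφy]

omit [IsManifold 𝓘(ℝ, E) ∞ M] in
lemma nablaAlong_congr (h : ∀ᶠ z in 𝓝 y, V z = W z) (v : TangentSpace 𝓘(ℝ, E) y) :
    nablaAlong φ V y v = nablaAlong φ W y v := by
  have hsnd : (fun z ↦ (trivializationAt F (TangentSpace 𝓘(ℝ, F) : N → Type _) (φ y) ⟨φ z, V z⟩).2)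
      =ᶠ[𝓝 y] fun z ↦
        (trivializationAt F (TangentSpace 𝓘(ℝ, F) : N → Type _) (φ y) ⟨φ z, W z⟩).2 :=
    h.mono fun z hz ↦ by simp only [hz]
  simp only [nablaAlong, mvfderiv, hsnd.mfderiv_eq, h.self_of_nhds]
  rfl

variable [IsContMDiffRiemannianBundle 𝓘(ℝ, F) ∞ F (fun p : N ↦ TangentSpace 𝓘(ℝ, F) p)]

theorem toCoord_nablaAlong (hy : y ∈ (chartAt E x₀).source) (hy₀ : φ y ∈ (chartAt F q₀).source)
    (hV : SmoothAlongAt E φ V y) (v : TangentSpace 𝓘(ℝ, E) y) :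
    toCoord q₀ (φ y) (nablaAlong φ V y v)
      = fderiv ℝ (alongRep x₀ q₀ φ V) (chartAt E x₀ y) (toCoord x₀ y v)
        + chr q₀ (chartAt F q₀ (φ y))
          (fderiv ℝ (mapCoord x₀ q₀ φ) (chartAt E x₀ y) (toCoord x₀ y v))
          (toCoord q₀ (φ y) (V y)) := by
  have hφy := mem_chart_source F (φ y)
  rw [nablaAlong_eq_fderiv hy hV, map_add, ← transCoord_chartAt hy₀,
    toCoord_nabla hy₀ (smoothAt_localExt _ hφy), toCoord_dmap hy hy₀ hV.contMDiffAt,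
    (coordRep_localExt_eventuallyEq_transCoord hy₀ hφy _).fderiv_eq, localExt_self,
    fderiv_clm_apply (differentiableAt_transCoord hy₀ hφy) (by fun_prop),
    fderiv_alongRep hy hy₀ hφy hV]
  simp [add_assoc]

lemma nablaAlong_add (hV : SmoothAlongAt E φ V y) (hW : SmoothAlongAt E φ W y)
    (v : TangentSpace 𝓘(ℝ, E) y) :
    nablaAlong φ (fun z ↦ V z + W z) y v = nablaAlong φ V y v + nablaAlong φ W y v := by
  have hy := mem_chart_source E y
  have hφy := mem_chart_source F (φ y)
  have hadd : alongRep (E := E) y (φ y) φ (fun z ↦ V z + W z)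
      = alongRep y (φ y) φ V + alongRep y (φ y) φ W := funext fun p ↦ map_add _ _ _
  refine toCoord_injective hφy ?_
  rw [map_add, toCoord_nablaAlong hy hφy (hV.add hW), toCoord_nablaAlong hy hφy hV,
    toCoord_nablaAlong hy hφy hW, hadd,
    fderiv_add ((hV.contDiffAt_alongRep hy hφy).differentiableAt (by simp))
      ((hW.contDiffAt_alongRep hy hφy).differentiableAt (by simp))]
  simp only [map_add, _root_.add_apply]
  abel

lemma nablaAlong_const_smul (hV : SmoothAlongAt E φ V y) (c : ℝ) (v : TangentSpace 𝓘(ℝ, E) y) :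
    nablaAlong φ (fun z ↦ c • V z) y v = c • nablaAlong φ V y v := by
  have hy := mem_chart_source E y
  have hφy := mem_chart_source F (φ y)
  have hsmul : alongRep (E := E) y (φ y) φ (fun z ↦ c • V z) = c • alongRep y (φ y) φ V :=
    funext fun p ↦ map_smul _ _ _
  refine toCoord_injective hφy ?_
  rw [map_smul, toCoord_nablaAlong hy hφy (hV.const_smul c), toCoord_nablaAlong hy hφy hV, hsmul,
    fderiv_const_smul ((hV.contDiffAt_alongRep hy hφy).differentiableAt (by simp))]
  simp only [map_smul, _root_.smul_apply, smul_add]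

lemma nablaAlong_neg (hV : SmoothAlongAt E φ V y) (v : TangentSpace 𝓘(ℝ, E) y) :
    nablaAlong φ (fun z ↦ -V z) y v = -nablaAlong φ V y v := by
  simpa only [neg_one_smul] using nablaAlong_const_smul hV (-1) v

lemma nablaAlong_sum {ι : Type*} [Fintype ι] {V : ι → Π x : M, TangentSpace 𝓘(ℝ, F) (φ x)}
    (hφ : ContMDiffAt 𝓘(ℝ, E) 𝓘(ℝ, F) ∞ φ y) (hV : ∀ i, SmoothAlongAt E φ (V i) y)
    (v : TangentSpace 𝓘(ℝ, E) y) :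
    nablaAlong φ (fun z ↦ ∑ i, V i z) y v = ∑ i, nablaAlong φ (V i) y v := by
  have hy := mem_chart_source E y
  have hφy := mem_chart_source F (φ y)
  have hV' (i) := (hV i).contDiffAt_alongRep hy hφy
  have hsum : alongRep (E := E) y (φ y) φ (fun z ↦ ∑ i, V i z)
      = fun p ↦ ∑ i, alongRep y (φ y) φ (V i) p := funext fun p ↦ map_sum _ _ _
  have hsmooth : SmoothAlongAt E φ (fun z ↦ ∑ i, V i z) y :=
    smoothAlongAt_of_contDiffAt hy hφy hφ (hsum ▸ ContDiffAt.sum fun i _ ↦ hV' i)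
  refine toCoord_injective hφy ?_
  rw [map_sum, toCoord_nablaAlong hy hφy hsmooth, hsum,
    fderiv_fun_sum fun i _ ↦ (hV' i).differentiableAt (by simp)]
  simp only [toCoord_nablaAlong hy hφy (hV _), map_sum, _root_.sum_apply, Finset.sum_add_distrib]

lemma nablaAlong_comp {Y : VectorField F N} (hY : SmoothAt Y (φ y))
    (hφ : ContMDiffAt 𝓘(ℝ, E) 𝓘(ℝ, F) ∞ φ y) (v : TangentSpace 𝓘(ℝ, E) y) :
    nablaAlong φ (fun z ↦ Y (φ z)) y v = nabla Y (φ y) (dmap E F φ y v) := by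
  have hy := mem_chart_source E y
  have hφy := mem_chart_source F (φ y)
  have hcomp : alongRep (E := E) y (φ y) φ (fun z ↦ Y (φ z))
      =ᶠ[𝓝 (chartAt E y y)] coordRep (φ y) Y ∘ mapCoord y (φ y) φ := by
    rw [eventuallyEq_nhds_chartAt hy]
    filter_upwards [(chartAt E y).open_source.mem_nhds hy,
      hφ.continuousAt ((chartAt F (φ y)).open_source.mem_nhds hφy)] with z hz hz'
    simp only [Function.comp_apply]
    rw [alongRep_chartAt hz, mapCoord_chartAt hz, coordRep_chartAt hz']
  have hY' := (hY.contDiffAt_coordRep hφy).differentiableAt (by simp)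
  rw [← mapCoord_chartAt hy] at hY'
  refine toCoord_injective hφy ?_
  rw [toCoord_nablaAlong hy hφy (hY.comp hφ), toCoord_nabla hφy hY, toCoord_dmap hy hφy hφ,
    hcomp.fderiv_eq, fderiv_comp _ hY' ((contDiffAt_mapCoord hy hφy hφ).differentiableAt (by simp)),
    mapCoord_chartAt hy]
  rfl

end Along

section Connection

variable {E : Type*} [NormedAddCommGroup E] [NormedSpace ℝ E] [FiniteDimensional ℝ E]
  {M : Type*} [TopologicalSpace M] [ChartedSpace E M] [IsManifold 𝓘(ℝ, E) ∞ M]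
  [RiemannianBundle (fun x : M ↦ TangentSpace 𝓘(ℝ, E) x)]
  [IsContMDiffRiemannianBundle 𝓘(ℝ, E) ∞ E (fun x : M ↦ TangentSpace 𝓘(ℝ, E) x)]
  {X Y : VectorField E M} {y : M}

lemma nablaAlong_id (hY : SmoothAt Y y) (v : TangentSpace 𝓘(ℝ, E) y) :
    nablaAlong id Y y v = nabla Y y v :=
  (nablaAlong_comp (φ := id) hY contMDiffAt_id v).trans (by rw [dmap, mfderiv_id]; rfl)

lemma nabla_const_smul (hX : SmoothAt X y) (c : ℝ) (v : TangentSpace 𝓘(ℝ, E) y) :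
    nabla (fun z ↦ c • X z) y v = c • nabla X y v := by
  have hcX : SmoothAt (fun z ↦ c • X z) y := hX.const_smul_section
  rw [← nablaAlong_id hcX, ← nablaAlong_id hX]
  exact nablaAlong_const_smul (φ := id) hX c v

lemma nabla_neg (hX : SmoothAt X y) (v : TangentSpace 𝓘(ℝ, E) y) :
    nabla (fun z ↦ -X z) y v = -nabla X y v := by
  simpa only [neg_one_smul] using nabla_const_smul hX (-1) v

end Connection

section CovDeriv

variable {E F : Type*} [NormedAddCommGroup E] [NormedSpace ℝ E] [NormedAddCommGroup F]
  [NormedSpace ℝ F] {Γ : F → F →L[ℝ] F →L[ℝ] F} {f s : E → F} {p : E}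

/-- The covariant derivative along `f` of a vector-valued function `s`, for the connection with
Christoffel symbols `Γ`. -/
def covDeriv (Γ : F → F →L[ℝ] F →L[ℝ] F) (f s : E → F) (p : E) : E →L[ℝ] F :=
  fderiv ℝ s p + ((Γ (f p)).flip (s p)).comp (fderiv ℝ f p)

/-- The curvature of the connection with Christoffel symbols `Γ`. -/
def curv (Γ : F → F →L[ℝ] F →L[ℝ] F) (q u v w : F) : F :=
  fderiv ℝ Γ q u v w - fderiv ℝ Γ q v u w + Γ q u (Γ q v w) - Γ q v (Γ q u w)

lemma isSymmSndFDerivAt_of_contDiffAt (hf : ContDiffAt ℝ ∞ f p) : IsSymmSndFDerivAt ℝ f p :=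
  hf.isSymmSndFDerivAt (by
    rw [minSmoothness_of_isRCLikeNormedField]; exact WithTop.coe_le_coe.2 le_top)

lemma contDiffAt_covDeriv (hΓ : ContDiffAt ℝ ∞ Γ (f p)) (hf : ContDiffAt ℝ ∞ f p)
    (hs : ContDiffAt ℝ ∞ s p) : ContDiffAt ℝ ∞ (covDeriv Γ f s) p :=
  have hflip : ContDiffAt ℝ ∞ (fun q ↦ (Γ (f q)).flip) p :=
    (ContinuousLinearMap.flipₗᵢ ℝ F F F).contDiff.contDiffAt.comp _ (hΓ.comp _ hf)
  (hs.fderiv_right (by simp)).add ((hflip.clm_apply hs).clm_comp (hf.fderiv_right (by simp)))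

lemma fderiv_covDeriv (hΓ : ContDiffAt ℝ ∞ Γ (f p)) (hf : ContDiffAt ℝ ∞ f p)
    (hs : ContDiffAt ℝ ∞ s p) (u v : E) :
    fderiv ℝ (covDeriv Γ f s) p u v
      = fderiv ℝ (fderiv ℝ s) p u v + Γ (f p) (fderiv ℝ (fderiv ℝ f) p u v) (s p)
        + Γ (f p) (fderiv ℝ f p v) (fderiv ℝ s p u)
        + fderiv ℝ Γ (f p) (fderiv ℝ f p u) (fderiv ℝ f p v) (s p) := by
  have hf' := (hf.differentiableAt (by simp)).hasFDerivAt
  have hs' := (hs.differentiableAt (by simp)).hasFDerivAt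
  have hdf := ((hf.fderiv_right (m := ∞) (by simp)).differentiableAt (by simp)).hasFDerivAt
  have hds := ((hs.fderiv_right (m := ∞) (by simp)).differentiableAt (by simp)).hasFDerivAt
  have hflip : HasFDerivAt (fun q ↦ (Γ (f q)).flip) _ p :=
    (ContinuousLinearMap.flipₗᵢ ℝ F F F).toContinuousLinearEquiv.hasFDerivAt.comp p
      ((hΓ.differentiableAt (by simp)).hasFDerivAt.comp p hf')
  have h : HasFDerivAt (covDeriv Γ f s) _ p := hds.add ((hflip.clm_apply hs').clm_comp hdf)
  rw [h.fderiv]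
  simp [add_assoc]

theorem covDeriv_covDeriv_sub (hΓ : ContDiffAt ℝ ∞ Γ (f p)) (hf : ContDiffAt ℝ ∞ f p)
    (hs : ContDiffAt ℝ ∞ s p) (u v : E) :
    fderiv ℝ (covDeriv Γ f s) p u v + Γ (f p) (fderiv ℝ f p u) (covDeriv Γ f s p v)
        - (fderiv ℝ (covDeriv Γ f s) p v u + Γ (f p) (fderiv ℝ f p v) (covDeriv Γ f s p u))
      = curv Γ (f p) (fderiv ℝ f p u) (fderiv ℝ f p v) (s p) := by
  rw [fderiv_covDeriv hΓ hf hs, fderiv_covDeriv hΓ hf hs,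
    (isSymmSndFDerivAt_of_contDiffAt hf).eq u v, (isSymmSndFDerivAt_of_contDiffAt hs).eq u v]
  simp only [covDeriv, curv, _root_.add_apply, ContinuousLinearMap.comp_apply,
    ContinuousLinearMap.flip_apply, map_add]
  abel

end CovDeriv

section HomFields

variable {E : Type*} [NormedAddCommGroup E] [NormedSpace ℝ E]
  {M : Type*} [TopologicalSpace M] [ChartedSpace E M] [IsManifold 𝓘(ℝ, E) ∞ M]
  {F : Type*} [NormedAddCommGroup F] [NormedSpace ℝ F]
  {N : Type*} [TopologicalSpace N] [ChartedSpace F N] [IsManifold 𝓘(ℝ, F) ∞ N]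
  {φ : M → N} {A : Π x : M, TangentSpace 𝓘(ℝ, E) x → TangentSpace 𝓘(ℝ, F) (φ x)}
  {D : E → E →L[ℝ] F} {V : Π x : M, TangentSpace 𝓘(ℝ, F) (φ x)} {W : VectorField E M} {y : M}

/-- `φ` is smooth at `y` and the smooth field `D` of linear maps represents, in the charts at `y`
and `φ y`, the maps `A z : T_z M → T_{φ z} N` for `z` near `y`. It says that `A` is a smooth section
of `T*M ⊗ φ⁻¹TN` near `y`. -/
structure IsHomRepAt (φ : M → N)
    (A : Π x : M, TangentSpace 𝓘(ℝ, E) x → TangentSpace 𝓘(ℝ, F) (φ x)) (D : E → E →L[ℝ] F)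
    (y : M) : Prop where
  contMDiffAt : ContMDiffAt 𝓘(ℝ, E) 𝓘(ℝ, F) ∞ φ y
  contDiffAt : ContDiffAt ℝ ∞ D (chartAt E y y)
  eventually_toCoord : ∀ᶠ z in 𝓝 y, ∀ v,
    toCoord (φ y) (φ z) (A z v) = D (chartAt E y z) (toCoord y z v)

lemma IsHomRepAt.toCoord_apply (hA : IsHomRepAt φ A D y) (v : TangentSpace 𝓘(ℝ, E) y) :
    toCoord (φ y) (φ y) (A y v) = D (chartAt E y y) (toCoord y y v) :=
  hA.eventually_toCoord.self_of_nhds v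

lemma IsHomRepAt.alongRep_eventuallyEq (hA : IsHomRepAt φ A D y) (W : VectorField E M) :
    alongRep y (φ y) φ (fun z ↦ A z (W z)) =ᶠ[𝓝 (chartAt E y y)] fun p ↦ D p (coordRep y W p) := by
  rw [eventuallyEq_nhds_chartAt (mem_chart_source E y)]
  filter_upwards [hA.eventually_toCoord,
    (chartAt E y).open_source.mem_nhds (mem_chart_source E y)] with z hAz hz
  simp only [Function.comp_apply]
  rw [alongRep_chartAt hz, coordRep_chartAt hz, hAz]

lemma IsHomRepAt.smoothAlongAt [FiniteDimensional ℝ F] (hA : IsHomRepAt φ A D y)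
    (hW : SmoothAt W y) :
    SmoothAlongAt E φ (fun z ↦ A z (W z)) y :=
  have hy := mem_chart_source E y
  smoothAlongAt_of_contDiffAt hy (mem_chart_source F (φ y)) hA.contMDiffAt
    ((hA.contDiffAt.clm_apply (hW.contDiffAt_coordRep hy)).congr_of_eventuallyEq
      (hA.alongRep_eventuallyEq W))

section Nabla

variable [FiniteDimensional ℝ F] [RiemannianBundle (fun p : N ↦ TangentSpace 𝓘(ℝ, F) p)]

section ToCoord

variable [IsContMDiffRiemannianBundle 𝓘(ℝ, F) ∞ F (fun p : N ↦ TangentSpace 𝓘(ℝ, F) p)]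

lemma IsHomRepAt.toCoord_nablaAlong (hA : IsHomRepAt φ A D y) (hW : SmoothAt W y)
    (u : TangentSpace 𝓘(ℝ, E) y) :
    toCoord (φ y) (φ y) (nablaAlong φ (fun z ↦ A z (W z)) y u)
      = fderiv ℝ D (chartAt E y y) (toCoord y y u) (toCoord y y (W y))
        + D (chartAt E y y) (fderiv ℝ (coordRep y W) (chartAt E y y) (toCoord y y u))
        + chr (φ y) (chartAt F (φ y) (φ y))
          (fderiv ℝ (mapCoord y (φ y) φ) (chartAt E y y) (toCoord y y u))
          (D (chartAt E y y) (toCoord y y (W y))) := by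
  have hy := mem_chart_source E y
  rw [BiharmonicHolomorphic.toCoord_nablaAlong hy (mem_chart_source F (φ y)) (hA.smoothAlongAt hW),
    (hA.alongRep_eventuallyEq W).fderiv_eq, hA.toCoord_apply,
    fderiv_clm_apply (hA.contDiffAt.differentiableAt (by simp))
      ((hW.contDiffAt_coordRep hy).differentiableAt (by simp)), coordRep_chartAt hy]
  simp only [_root_.add_apply, ContinuousLinearMap.comp_apply, ContinuousLinearMap.flip_apply]
  abel

end ToCoord

variable [FiniteDimensional ℝ E] [RiemannianBundle (fun x : M ↦ TangentSpace 𝓘(ℝ, E) x)]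

/-- The covariant derivative `(∇_u A) v = ∇^φ_u (A V) - A (∇_u V)` of a section `A` of
`T*M ⊗ φ⁻¹TN`, where `V` extends `v`. The second fundamental form is the case `A = dφ`, the second
covariant derivative of a section `V` of `φ⁻¹TN` is the case `A = ∇^φ V`. -/
def nablaHom (φ : M → N) (A : Π x : M, TangentSpace 𝓘(ℝ, E) x → TangentSpace 𝓘(ℝ, F) (φ x))
    (x : M) (u v : TangentSpace 𝓘(ℝ, E) x) : TangentSpace 𝓘(ℝ, F) (φ x) :=
  nablaAlong φ (fun z ↦ A z (localExt v z)) x u - A x (nabla (localExt v) x u)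

variable [IsContMDiffRiemannianBundle 𝓘(ℝ, F) ∞ F (fun p : N ↦ TangentSpace 𝓘(ℝ, F) p)]
  [IsContMDiffRiemannianBundle 𝓘(ℝ, E) ∞ E (fun x : M ↦ TangentSpace 𝓘(ℝ, E) x)]

theorem IsHomRepAt.toCoord_nablaHom (hA : IsHomRepAt φ A D y) (u v : TangentSpace 𝓘(ℝ, E) y) :
    toCoord (φ y) (φ y) (nablaHom φ A y u v)
      = fderiv ℝ D (chartAt E y y) (toCoord y y u) (toCoord y y v)
        + chr (φ y) (chartAt F (φ y) (φ y))
          (fderiv ℝ (mapCoord y (φ y) φ) (chartAt E y y) (toCoord y y u))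
          (D (chartAt E y y) (toCoord y y v))
        - D (chartAt E y y) (chr y (chartAt E y y) (toCoord y y u) (toCoord y y v)) := by
  have hy := mem_chart_source E y
  rw [nablaHom, map_sub, hA.toCoord_nablaAlong (smoothAt_localExt v hy), hA.toCoord_apply,
    toCoord_nabla_localExt, (coordRep_localExt_eventuallyEq v hy).fderiv_eq, localExt_self]
  simp

theorem IsHomRepAt.nablaAlong_apply (hA : IsHomRepAt φ A D y) (hW : SmoothAt W y)
    (u : TangentSpace 𝓘(ℝ, E) y) :
    nablaAlong φ (fun z ↦ A z (W z)) y u = nablaHom φ A y u (W y) + A y (nabla W y u) := by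
  refine toCoord_injective (mem_chart_source F (φ y)) ?_
  rw [map_add, hA.toCoord_nablaAlong hW, hA.toCoord_nablaHom, hA.toCoord_apply,
    toCoord_nabla (mem_chart_source E y) hW, map_add]
  abel

/-- `∇A` at a point as a bilinear map. -/
def IsHomRepAt.nablaHomBilin (hA : IsHomRepAt φ A D y) :
    TangentSpace 𝓘(ℝ, E) y →ₗ[ℝ] TangentSpace 𝓘(ℝ, E) y →ₗ[ℝ] TangentSpace 𝓘(ℝ, F) (φ y) :=
  LinearMap.mk₂ ℝ (nablaHom φ A y)
    (fun u u' v ↦ toCoord_injective (mem_chart_source F (φ y)) (by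
      simp only [hA.toCoord_nablaHom, map_add, _root_.add_apply]; abel))
    (fun c u v ↦ toCoord_injective (mem_chart_source F (φ y)) (by
      simp only [hA.toCoord_nablaHom, map_smul, _root_.smul_apply, smul_add, smul_sub]))
    (fun u v v' ↦ toCoord_injective (mem_chart_source F (φ y)) (by
      simp only [hA.toCoord_nablaHom, map_add]; abel))
    (fun c u v ↦ toCoord_injective (mem_chart_source F (φ y)) (by
      simp only [hA.toCoord_nablaHom, map_smul, smul_add, smul_sub]))

end Nabla

lemma isHomRepAt_dmap [CompleteSpace E] (hφ : ContMDiff 𝓘(ℝ, E) 𝓘(ℝ, F) ∞ φ) (y : M) :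
    IsHomRepAt φ (fun z ↦ dmap E F φ z) (fderiv ℝ (mapCoord y (φ y) φ)) y where
  contMDiffAt := hφ y
  contDiffAt := (contDiffAt_mapCoord (mem_chart_source E y) (mem_chart_source F (φ y))
    (hφ y)).fderiv_right (by simp)
  eventually_toCoord := by
    filter_upwards [(chartAt E y).open_source.mem_nhds (mem_chart_source E y),
      hφ.continuous.continuousAt
        ((chartAt F (φ y)).open_source.mem_nhds (mem_chart_source F (φ y)))] with z hz hφz v
    using toCoord_dmap hz hφz (hφ z) v

section NablaAlong

variable [FiniteDimensional ℝ F] [RiemannianBundle (fun p : N ↦ TangentSpace 𝓘(ℝ, F) p)]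
  [IsContMDiffRiemannianBundle 𝓘(ℝ, F) ∞ F (fun p : N ↦ TangentSpace 𝓘(ℝ, F) p)]

lemma isHomRepAt_nablaAlong (hV : ∀ᶠ z in 𝓝 y, SmoothAlongAt E φ V z) :
    IsHomRepAt φ (nablaAlong (E := E) φ V)
      (covDeriv (chr (φ y)) (mapCoord y (φ y) φ) (alongRep y (φ y) φ V)) y where
  contMDiffAt := hV.self_of_nhds.contMDiffAt
  contDiffAt := by
    have hy := mem_chart_source E y
    have hφy := mem_chart_source F (φ y)
    have hV' := hV.self_of_nhds.contDiffAt_alongRep hy hφy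
    have hmap := contDiffAt_mapCoord hy hφy hV.self_of_nhds.contMDiffAt
    have hchr := contDiffAt_chr ((chartAt F (φ y)).map_source hφy)
    rw [← mapCoord_chartAt hy (φ y) φ] at hchr
    exact contDiffAt_covDeriv hchr hmap hV'
  eventually_toCoord := by
    filter_upwards [hV, (chartAt E y).open_source.mem_nhds (mem_chart_source E y),
      hV.self_of_nhds.contMDiffAt.continuousAt
        ((chartAt F (φ y)).open_source.mem_nhds (mem_chart_source F (φ y)))] with z hVz hz hφz v
    rw [toCoord_nablaAlong hz hφz hVz, covDeriv, mapCoord_chartAt hz, alongRep_chartAt hz]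
    rfl

lemma smoothAlongAt_nablaAlong (hV : ∀ᶠ z in 𝓝 y, SmoothAlongAt E φ V z) (hW : SmoothAt W y) :
    SmoothAlongAt E φ (fun z ↦ nablaAlong φ V z (W z)) y :=
  (isHomRepAt_nablaAlong hV).smoothAlongAt hW

end NablaAlong

end HomFields

section SecondFundamentalForm

variable {E : Type*} [NormedAddCommGroup E] [NormedSpace ℝ E] [FiniteDimensional ℝ E]
  {M : Type*} [TopologicalSpace M] [ChartedSpace E M] [IsManifold 𝓘(ℝ, E) ∞ M]
  [RiemannianBundle (fun x : M ↦ TangentSpace 𝓘(ℝ, E) x)]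
  [IsContMDiffRiemannianBundle 𝓘(ℝ, E) ∞ E (fun x : M ↦ TangentSpace 𝓘(ℝ, E) x)]
  {y : M} {X Y : VectorField E M}

lemma smoothAt_nabla (hX : SmoothAt X y) (hY : ∀ᶠ z in 𝓝 y, SmoothAt Y z) :
    SmoothAt (fun z ↦ nabla Y z (X z)) y :=
  (smoothAlongAt_nablaAlong (φ := id) hY hX).congr
    (hY.mono fun z hz ↦ (nablaAlong_id hz (X z)).symm)

variable {F : Type*} [NormedAddCommGroup F] [NormedSpace ℝ F] [FiniteDimensional ℝ F]
  {N : Type*} [TopologicalSpace N] [ChartedSpace F N] [IsManifold 𝓘(ℝ, F) ∞ N]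
  [RiemannianBundle (fun p : N ↦ TangentSpace 𝓘(ℝ, F) p)]
  [IsContMDiffRiemannianBundle 𝓘(ℝ, F) ∞ F (fun p : N ↦ TangentSpace 𝓘(ℝ, F) p)]
  {φ : M → N} (hφ : ContMDiff 𝓘(ℝ, E) 𝓘(ℝ, F) ∞ φ)
include hφ

theorem nablaAlong_dmap (hY : SmoothAt Y y) (u : TangentSpace 𝓘(ℝ, E) y) :
    nablaAlong φ (fun z ↦ dmap E F φ z (Y z)) y u
      = secondFundamentalForm φ y u (Y y) + dmap E F φ y (nabla Y y u) :=
  (isHomRepAt_dmap hφ y).nablaAlong_apply hY u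

/-- The second fundamental form as a bilinear map. -/
def sffBilin (y : M) :
    TangentSpace 𝓘(ℝ, E) y →ₗ[ℝ] TangentSpace 𝓘(ℝ, E) y →ₗ[ℝ] TangentSpace 𝓘(ℝ, F) (φ y) :=
  (isHomRepAt_dmap hφ y).nablaHomBilin

lemma sffBilin_apply (u v : TangentSpace 𝓘(ℝ, E) y) :
    sffBilin hφ y u v = secondFundamentalForm φ y u v := rfl

theorem secondFundamentalForm_comm (u v : TangentSpace 𝓘(ℝ, E) y) :
    secondFundamentalForm (F := F) φ y u v = secondFundamentalForm φ y v u := by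
  have hy := mem_chart_source E y
  have hφy := mem_chart_source F (φ y)
  have hsymm := isSymmSndFDerivAt_of_contDiffAt (contDiffAt_mapCoord hy hφy (hφ y))
  change nablaHom φ (fun z ↦ dmap E F φ z) y u v = nablaHom φ (fun z ↦ dmap E F φ z) y v u
  refine toCoord_injective hφy ?_
  rw [(isHomRepAt_dmap hφ y).toCoord_nablaHom, (isHomRepAt_dmap hφ y).toCoord_nablaHom, hsymm.eq,
    chr_comm ((chartAt E y).map_source hy), chr_comm ((chartAt F (φ y)).map_source hφy)]

lemma smoothAlongAt_secondFundamentalForm (hX : SmoothAt X y) (hY : ∀ᶠ z in 𝓝 y, SmoothAt Y z) :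
    SmoothAlongAt E φ (fun z ↦ secondFundamentalForm (F := F) φ z (X z) (Y z)) y := by
  have hdY : ∀ᶠ z in 𝓝 y, SmoothAlongAt E φ (fun z ↦ dmap E F φ z (Y z)) z :=
    hY.mono fun z hz ↦ hz.smoothAlongAt_dmap hφ
  refine ((smoothAlongAt_nablaAlong hdY hX).add
    (((smoothAt_nabla hX hY).smoothAlongAt_dmap hφ).const_smul (-1))).congr ?_
  filter_upwards [hY] with z hz
  rw [nablaAlong_dmap hφ hz, neg_one_smul, add_neg_cancel_right]

theorem nablaAlong_nablaAlong_dmap (hX : SmoothAt X y) (hY : ∀ᶠ z in 𝓝 y, SmoothAt Y z)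
    (u : TangentSpace 𝓘(ℝ, E) y) :
    nablaAlong φ (fun z ↦ nablaAlong φ (fun w ↦ dmap E F φ w (Y w)) z (X z)) y u
      = nablaAlong φ (fun z ↦ secondFundamentalForm φ z (X z) (Y z)) y u
        + secondFundamentalForm φ y u (nabla Y y (X y))
        + dmap E F φ y (nabla (fun z ↦ nabla Y z (X z)) y u) := by
  have hXY := smoothAt_nabla hX hY
  rw [nablaAlong_congr (hY.mono fun z hz ↦ nablaAlong_dmap hφ hz (X z)),
    nablaAlong_add (smoothAlongAt_secondFundamentalForm hφ hX hY) (hXY.smoothAlongAt_dmap hφ),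
    nablaAlong_dmap hφ hXY, add_assoc]

end SecondFundamentalForm

section RicciIdentity

variable {E : Type*} [NormedAddCommGroup E] [NormedSpace ℝ E] [FiniteDimensional ℝ E]
  {M : Type*} [TopologicalSpace M] [ChartedSpace E M] [IsManifold 𝓘(ℝ, E) ∞ M]
  [RiemannianBundle (fun x : M ↦ TangentSpace 𝓘(ℝ, E) x)]
  [IsContMDiffRiemannianBundle 𝓘(ℝ, E) ∞ E (fun x : M ↦ TangentSpace 𝓘(ℝ, E) x)]
  {y : M} {Y : VectorField E M}

section Along

variable {F : Type*} [NormedAddCommGroup F] [NormedSpace ℝ F] [FiniteDimensional ℝ F]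
  {N : Type*} [TopologicalSpace N] [ChartedSpace F N] [IsManifold 𝓘(ℝ, F) ∞ N]
  [RiemannianBundle (fun p : N ↦ TangentSpace 𝓘(ℝ, F) p)]
  [IsContMDiffRiemannianBundle 𝓘(ℝ, F) ∞ F (fun p : N ↦ TangentSpace 𝓘(ℝ, F) p)]
  {φ : M → N} {V : Π x : M, TangentSpace 𝓘(ℝ, F) (φ x)}

lemma toCoord_nablaHom_nablaAlong_sub (hV : ∀ᶠ z in 𝓝 y, SmoothAlongAt E φ V z)
    (u v : TangentSpace 𝓘(ℝ, E) y) :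
    toCoord (φ y) (φ y)
        (nablaHom φ (nablaAlong φ V) y u v - nablaHom φ (nablaAlong φ V) y v u)
      = curv (chr (φ y)) (chartAt F (φ y) (φ y)) (toCoord (φ y) (φ y) (dmap E F φ y u))
          (toCoord (φ y) (φ y) (dmap E F φ y v)) (toCoord (φ y) (φ y) (V y)) := by
  have hy := mem_chart_source E y
  have hφy := mem_chart_source F (φ y)
  have hVy : SmoothAlongAt E φ V y := hV.self_of_nhds
  have hΓ := contDiffAt_chr ((chartAt F (φ y)).map_source hφy)
  rw [← mapCoord_chartAt hy (φ y) φ] at hΓ ⊢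
  rw [toCoord_dmap hy hφy hVy.contMDiffAt, toCoord_dmap hy hφy hVy.contMDiffAt,
    ← alongRep_chartAt hy (φ y) φ V, ← covDeriv_covDeriv_sub hΓ
      (contDiffAt_mapCoord hy hφy hVy.contMDiffAt) (hVy.contDiffAt_alongRep hy hφy), map_sub,
    (isHomRepAt_nablaAlong hV).toCoord_nablaHom, (isHomRepAt_nablaAlong hV).toCoord_nablaHom,
    chr_comm ((chartAt E y).map_source hy) (toCoord y y u), mapCoord_chartAt hy]
  abel

end Along

/-- The second covariant derivative `∇²_{u,v} Y = ∇_u ∇_V Y - ∇_{∇_u V} Y` of a vector field, where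
`V` extends `v`. Its metric trace is the rough Laplacian. -/
def secondCovDeriv (Y : VectorField E M) (y : M) (u v : TangentSpace 𝓘(ℝ, E) y) :
    TangentSpace 𝓘(ℝ, E) y :=
  nabla (fun z ↦ nabla Y z (localExt v z)) y u - nabla Y y (nabla (localExt v) y u)

lemma nablaHom_nablaAlong_id (hY : ∀ᶠ z in 𝓝 y, SmoothAt Y z) (u v : TangentSpace 𝓘(ℝ, E) y) :
    nablaHom id (nablaAlong id Y) y u v = secondCovDeriv Y y u v := by
  have hYv := smoothAt_nabla (smoothAt_localExt v (mem_chart_source E y)) hY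
  rw [nablaHom, nablaAlong_congr (φ := id) (hY.mono fun z hz ↦ nablaAlong_id hz (localExt v z)),
    nablaAlong_id hYv, nablaAlong_id hY.self_of_nhds, secondCovDeriv]

theorem toCoord_curvature (u v w : TangentSpace 𝓘(ℝ, E) y) :
    toCoord y y (curvature y u v w)
      = curv (chr y) (chartAt E y y) (toCoord y y u) (toCoord y y v) (toCoord y y w) := by
  have hw := eventually_smoothAt_localExt w
  have hzero : nabla (localExt w) y 0 = 0 :=
    toCoord_injective (mem_chart_source E y) (by simp [toCoord_nabla_localExt])
  have hcurv : curvature y u v w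
      = secondCovDeriv (localExt w) y u v - secondCovDeriv (localExt w) y v u := by
    rw [curvature, secondCovDeriv, secondCovDeriv, mlieBracket_localExt, nabla_localExt_comm u v,
      hzero, sub_zero, sub_sub_sub_cancel_right]
  rw [hcurv, ← nablaHom_nablaAlong_id hw, ← nablaHom_nablaAlong_id hw]
  exact (toCoord_nablaHom_nablaAlong_sub (φ := id) hw u v).trans (by
    rw [dmap, mfderiv_id, localExt_self]; rfl)

lemma curvature_neg_left (u v w : TangentSpace 𝓘(ℝ, E) y) :
    curvature y (-u) v w = -curvature y u v w := by
  refine toCoord_injective (mem_chart_source E y) ?_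
  rw [map_neg, toCoord_curvature, toCoord_curvature]
  simp only [curv, map_neg, _root_.neg_apply]
  abel

/-- The bilinear map `(v, w) ↦ R(u, v) w`, whose metric trace is the Ricci operator. -/
def curvatureBilin (y : M) (u : TangentSpace 𝓘(ℝ, E) y) :
    TangentSpace 𝓘(ℝ, E) y →ₗ[ℝ] TangentSpace 𝓘(ℝ, E) y →ₗ[ℝ] TangentSpace 𝓘(ℝ, E) y :=
  LinearMap.mk₂ ℝ (curvature y u)
    (fun v v' w ↦ toCoord_injective (mem_chart_source E y) (by
      simp only [toCoord_curvature, curv, map_add, _root_.add_apply]; abel))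
    (fun c v w ↦ toCoord_injective (mem_chart_source E y) (by
      simp only [toCoord_curvature, curv, map_smul, _root_.smul_apply, smul_add, smul_sub]))
    (fun v w w' ↦ toCoord_injective (mem_chart_source E y) (by
      simp only [toCoord_curvature, curv, map_add]; abel))
    (fun c v w ↦ toCoord_injective (mem_chart_source E y) (by
      simp only [toCoord_curvature, curv, map_smul, smul_add, smul_sub]))

end RicciIdentity

section JacobiIdentity

variable {E : Type*} [NormedAddCommGroup E] [NormedSpace ℝ E] [FiniteDimensional ℝ E]
  {M : Type*} [TopologicalSpace M] [ChartedSpace E M] [IsManifold 𝓘(ℝ, E) ∞ M]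
  [RiemannianBundle (fun x : M ↦ TangentSpace 𝓘(ℝ, E) x)]
  [IsContMDiffRiemannianBundle 𝓘(ℝ, E) ∞ E (fun x : M ↦ TangentSpace 𝓘(ℝ, E) x)]
  {F : Type*} [NormedAddCommGroup F] [NormedSpace ℝ F] [FiniteDimensional ℝ F]
  {N : Type*} [TopologicalSpace N] [ChartedSpace F N] [IsManifold 𝓘(ℝ, F) ∞ N]
  [RiemannianBundle (fun p : N ↦ TangentSpace 𝓘(ℝ, F) p)]
  [IsContMDiffRiemannianBundle 𝓘(ℝ, F) ∞ F (fun p : N ↦ TangentSpace 𝓘(ℝ, F) p)]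
  {φ : M → N} {V : Π x : M, TangentSpace 𝓘(ℝ, F) (φ x)} {y : M} {e ξ : VectorField E M}

theorem nablaHom_nablaAlong_sub (hV : ∀ᶠ z in 𝓝 y, SmoothAlongAt E φ V z)
    (u v : TangentSpace 𝓘(ℝ, E) y) :
    nablaHom φ (nablaAlong φ V) y u v - nablaHom φ (nablaAlong φ V) y v u
      = curvature (φ y) (dmap E F φ y u) (dmap E F φ y v) (V y) :=
  toCoord_injective (mem_chart_source F (φ y)) (by
    rw [toCoord_nablaHom_nablaAlong_sub hV, toCoord_curvature])

lemma secondCovDeriv_sub (hξ : ∀ᶠ z in 𝓝 y, SmoothAt ξ z) (u v : TangentSpace 𝓘(ℝ, E) y) :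
    secondCovDeriv ξ y u v - secondCovDeriv ξ y v u = curvature y u v (ξ y) := by
  rw [← nablaHom_nablaAlong_id hξ, ← nablaHom_nablaAlong_id hξ]
  exact (nablaHom_nablaAlong_sub (φ := id) hξ u v).trans (by rw [dmap, mfderiv_id]; rfl)

lemma nabla_nabla (hξ : ∀ᶠ z in 𝓝 y, SmoothAt ξ z) (he : SmoothAt e y)
    (u : TangentSpace 𝓘(ℝ, E) y) :
    nabla (fun z ↦ nabla ξ z (e z)) y u
      = secondCovDeriv ξ y u (e y) + nabla ξ y (nabla e y u) := by
  rw [← nablaAlong_id (smoothAt_nabla he hξ), ← nablaAlong_id hξ.self_of_nhds,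
    ← nablaAlong_congr (φ := id) (hξ.mono fun z hz ↦ nablaAlong_id hz (e z)),
    ← nablaHom_nablaAlong_id hξ]
  exact (isHomRepAt_nablaAlong (φ := id) hξ).nablaAlong_apply he u

lemma nablaHom_nablaAlong_dmap (hφ : ContMDiff 𝓘(ℝ, E) 𝓘(ℝ, F) ∞ φ)
    (hξ : ∀ᶠ z in 𝓝 y, SmoothAt ξ z) (he : SmoothAt e y) (u : TangentSpace 𝓘(ℝ, E) y) :
    nablaHom φ (nablaAlong φ fun z ↦ dmap E F φ z (ξ z)) y u (e y)
      = dmap E F φ y (secondCovDeriv ξ y u (e y))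
        + nablaAlong φ (fun z ↦ secondFundamentalForm φ z (e z) (ξ z)) y u
        + secondFundamentalForm φ y u (nabla ξ y (e y))
        - secondFundamentalForm φ y (nabla e y u) (ξ y) := by
  have hdξ : ∀ᶠ z in 𝓝 y, SmoothAlongAt E φ (fun z ↦ dmap E F φ z (ξ z)) z :=
    hξ.mono fun z hz ↦ hz.smoothAlongAt_dmap hφ
  have hleibniz := (isHomRepAt_nablaAlong hdξ).nablaAlong_apply he u
  rw [nablaAlong_nablaAlong_dmap hφ he hξ, nabla_nabla hξ he, map_add,
    nablaAlong_dmap hφ hξ.self_of_nhds] at hleibniz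
  rw [eq_sub_of_add_eq hleibniz.symm]
  abel

theorem nablaHom_nablaAlong_dmap_add_curvature (hφ : ContMDiff 𝓘(ℝ, E) 𝓘(ℝ, F) ∞ φ)
    (hξ : ∀ᶠ z in 𝓝 y, SmoothAt ξ z) (he : ∀ᶠ z in 𝓝 y, SmoothAt e z) :
    nablaHom φ (nablaAlong φ fun z ↦ dmap E F φ z (ξ z)) y (e y) (e y)
        + curvature (φ y) (dmap E F φ y (ξ y)) (dmap E F φ y (e y)) (dmap E F φ y (e y))
      = dmap E F φ y (secondCovDeriv ξ y (e y) (e y) + curvature y (ξ y) (e y) (e y))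
        + nablaAlong φ (fun z ↦ secondFundamentalForm φ z (e z) (e z)) y (ξ y)
        + (secondFundamentalForm φ y (e y) (nabla ξ y (e y))
          + secondFundamentalForm φ y (nabla ξ y (e y)) (e y))
        - (secondFundamentalForm φ y (e y) (nabla e y (ξ y))
          + secondFundamentalForm φ y (nabla e y (ξ y)) (e y)) := by
  have hde : ∀ᶠ z in 𝓝 y, SmoothAlongAt E φ (fun z ↦ dmap E F φ z (e z)) z :=
    he.mono fun z hz ↦ hz.smoothAlongAt_dmap hφ
  rw [← nablaHom_nablaAlong_sub hde, ← secondCovDeriv_sub he, map_add, map_sub,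
    nablaHom_nablaAlong_dmap hφ hξ he.self_of_nhds, nablaHom_nablaAlong_dmap hφ he he.self_of_nhds,
    nablaHom_nablaAlong_dmap hφ he hξ.self_of_nhds,
    secondFundamentalForm_comm hφ (nabla e y (e y)),
    funext fun z ↦ secondFundamentalForm_comm hφ (y := z) (ξ z) (e z)]
  abel

end JacobiIdentity

section Endomorphisms

variable {E : Type*} [NormedAddCommGroup E] [NormedSpace ℝ E] [FiniteDimensional ℝ E]
  {M : Type*} [TopologicalSpace M] [ChartedSpace E M] [IsManifold 𝓘(ℝ, E) ∞ M]
  {A : EndField E M} {Y : VectorField E M} {y : M}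

/-- Smoothness of a field of endomorphisms, as it is required of an almost complex structure. -/
abbrev SmoothEnd (A : EndField E M) : Prop :=
  ContMDiff 𝓘(ℝ, E) (𝓘(ℝ, E).prod 𝓘(ℝ, E →L[ℝ] E)) ∞
    (fun x ↦ Bundle.TotalSpace.mk' (E →L[ℝ] E)
      (E := fun x : M ↦ TangentSpace 𝓘(ℝ, E) x →L[ℝ] TangentSpace 𝓘(ℝ, E) x) x (A x))

omit [FiniteDimensional ℝ E] in
lemma SmoothEnd.smoothAt_apply (hA : SmoothEnd A) (hY : SmoothAt Y y) :
    SmoothAt (fun z ↦ A z (Y z)) y :=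
  ContMDiffAt.clm_bundle_apply (F₁ := E) (F₂ := E) (E₁ := fun x : M ↦ TangentSpace 𝓘(ℝ, E) x)
    (E₂ := fun x : M ↦ TangentSpace 𝓘(ℝ, E) x) (b := fun z : M ↦ z) (ϕ := A) (v := Y) (hA y) hY

/-- The coordinate expression of a field of endomorphisms in the chart at `x₀`. -/
def endCoord (A : EndField E M) (x₀ : M) (p : E) : E →L[ℝ] E :=
  (toCoord x₀ ((chartAt E x₀).symm p)).comp
    ((A ((chartAt E x₀).symm p)).comp (ofCoord x₀ ((chartAt E x₀).symm p)))

lemma contDiffAt_endCoord (hA : SmoothEnd A) {x₀ : M} {p : E} (hp : p ∈ (chartAt E x₀).target) :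
    ContDiffAt ℝ ∞ (endCoord A x₀) p := by
  suffices ContDiffOn ℝ ∞ (endCoord A x₀) (chartAt E x₀).target from
    this.contDiffAt ((chartAt E x₀).open_target.mem_nhds hp)
  rw [contDiffOn_clm_apply]
  exact fun u r hr ↦ (SmoothAt.contDiffAt_coordRep_of_mem_target hr (hA.smoothAt_apply
    (smoothAt_ofCoord ((chartAt E x₀).map_target hr) u))).contDiffWithinAt

omit [FiniteDimensional ℝ E] in
lemma toCoord_end {x₀ z : M} (hz : z ∈ (chartAt E x₀).source) (v : TangentSpace 𝓘(ℝ, E) z) :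
    toCoord x₀ z (A z v) = endCoord A x₀ (chartAt E x₀ z) (toCoord x₀ z v) := by
  simp only [endCoord, ContinuousLinearMap.comp_apply]
  rw [(chartAt E x₀).left_inv hz, ofCoord_toCoord hz]

omit [FiniteDimensional ℝ E] in
lemma alongRep_end_eventuallyEq {E' : Type*} [NormedAddCommGroup E'] {M' : Type*}
    [TopologicalSpace M'] [ChartedSpace E' M'] {φ : M' → M} {x : M'}
    (hφ : ContinuousAt φ x) (V : Π x : M', TangentSpace 𝓘(ℝ, E) (φ x)) :
    alongRep (E := E') x (φ x) φ (fun z ↦ A (φ z) (V z))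
      =ᶠ[𝓝 (chartAt E' x x)] fun p ↦ endCoord A (φ x) (mapCoord x (φ x) φ p)
        (alongRep x (φ x) φ V p) := by
  rw [eventuallyEq_nhds_chartAt (mem_chart_source E' x)]
  filter_upwards [(chartAt E' x).open_source.mem_nhds (mem_chart_source E' x),
    hφ ((chartAt E (φ x)).open_source.mem_nhds (mem_chart_source E (φ x)))] with z hz hφz
  simp only [Function.comp_apply]
  rw [alongRep_chartAt hz, alongRep_chartAt hz, mapCoord_chartAt hz, toCoord_end hφz]

lemma isHomRepAt_end (hA : SmoothEnd A) (y : M) :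
    IsHomRepAt id (fun z ↦ A z) (endCoord A y) y where
  contMDiffAt := contMDiffAt_id
  contDiffAt := contDiffAt_endCoord hA ((chartAt E y).map_source (mem_chart_source E y))
  eventually_toCoord := by
    filter_upwards [(chartAt E y).open_source.mem_nhds (mem_chart_source E y)] with z hz v
    using toCoord_end hz v

variable [RiemannianBundle (fun x : M ↦ TangentSpace 𝓘(ℝ, E) x)]
  [IsContMDiffRiemannianBundle 𝓘(ℝ, E) ∞ E (fun x : M ↦ TangentSpace 𝓘(ℝ, E) x)]

lemma nablaHom_id_end (hA : SmoothEnd A) (u v : TangentSpace 𝓘(ℝ, E) y) :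
    nablaHom id (fun z ↦ A z) y u v = nablaJ A y u v := by
  have hAv := hA.smoothAt_apply (smoothAt_localExt v (mem_chart_source E y))
  rw [nablaHom, nablaAlong_id hAv, nablaJ]

/-- `∇A` at a point as a bilinear map. -/
def nablaJBilin (hA : SmoothEnd A) (y : M) :
    TangentSpace 𝓘(ℝ, E) y →ₗ[ℝ] TangentSpace 𝓘(ℝ, E) y →ₗ[ℝ] TangentSpace 𝓘(ℝ, E) y :=
  (isHomRepAt_end hA y).nablaHomBilin

lemma nablaJBilin_apply (hA : SmoothEnd A) (u v : TangentSpace 𝓘(ℝ, E) y) :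
    nablaJBilin hA y u v = nablaJ A y u v :=
  nablaHom_id_end hA u v

lemma toCoord_nablaJ (hA : SmoothEnd A) (u v : TangentSpace 𝓘(ℝ, E) y) :
    toCoord y y (nablaJ A y u v)
      = fderiv ℝ (endCoord A y) (chartAt E y y) (toCoord y y u) (toCoord y y v)
        + chr y (chartAt E y y) (toCoord y y u) (endCoord A y (chartAt E y y) (toCoord y y v))
        - endCoord A y (chartAt E y y) (chr y (chartAt E y y) (toCoord y y u) (toCoord y y v)) := by
  have hy := mem_chart_source E y
  have hid : fderiv ℝ (mapCoord y y id) (chartAt E y y) (toCoord y y u) = toCoord y y u := by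
    rw [← toCoord_dmap hy hy contMDiffAt_id, dmap, mfderiv_id]
    rfl
  rw [← nablaHom_id_end hA]
  refine ((isHomRepAt_end hA y).toCoord_nablaHom u v).trans ?_
  rw [id, hid]

section Along

variable {E' : Type*} [NormedAddCommGroup E'] [NormedSpace ℝ E']
  {M' : Type*} [TopologicalSpace M'] [ChartedSpace E' M'] [IsManifold 𝓘(ℝ, E') ∞ M']
  {φ : M' → M} {V : Π x : M', TangentSpace 𝓘(ℝ, E) (φ x)} {x : M'}

lemma nablaAlong_end (hA : SmoothEnd A) (hV : SmoothAlongAt E' φ V x)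
    (u : TangentSpace 𝓘(ℝ, E') x) :
    nablaAlong φ (fun z ↦ A (φ z) (V z)) x u
      = nablaJ A (φ x) (dmap E' E φ x u) (V x) + A (φ x) (nablaAlong φ V x u) := by
  have hx := mem_chart_source E' x
  have hφx := mem_chart_source E (φ x)
  have hmap := (contDiffAt_mapCoord hx hφx hV.contMDiffAt).differentiableAt (by simp)
  have hrep := (hV.contDiffAt_alongRep hx hφx).differentiableAt (by simp)
  have hend := contDiffAt_endCoord hA ((chartAt E (φ x)).map_source hφx)
  rw [← mapCoord_chartAt hx (φ x) φ] at hend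
  have hAV : SmoothAlongAt E' φ (fun z ↦ A (φ z) (V z)) x :=
    smoothAlongAt_of_contDiffAt hx hφx hV.contMDiffAt
      (((hend.comp _ (contDiffAt_mapCoord hx hφx hV.contMDiffAt)).clm_apply
        (hV.contDiffAt_alongRep hx hφx)).congr_of_eventuallyEq
          (alongRep_end_eventuallyEq hV.contMDiffAt.continuousAt V))
  have hd := ((hend.differentiableAt (by simp)).hasFDerivAt.comp _ hmap.hasFDerivAt).clm_apply
    hrep.hasFDerivAt
  refine toCoord_injective hφx ?_
  rw [toCoord_nablaAlong hx hφx hAV, map_add, toCoord_end hφx, toCoord_nablaJ hA,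
    toCoord_end hφx, toCoord_nablaAlong hx hφx hV, toCoord_dmap hx hφx hV.contMDiffAt,
    (hd.congr_of_eventuallyEq (alongRep_end_eventuallyEq hV.contMDiffAt.continuousAt V)).fderiv,
    mapCoord_chartAt hx, alongRep_chartAt hx]
  simp only [_root_.add_apply, ContinuousLinearMap.comp_apply, ContinuousLinearMap.flip_apply,
    Function.comp_apply, map_add, mapCoord_chartAt hx]
  abel

end Along

lemma nabla_end (hA : SmoothEnd A) (hY : SmoothAt Y y) (u : TangentSpace 𝓘(ℝ, E) y) :
    nabla (fun z ↦ A z (Y z)) y u = nablaJ A y u (Y y) + A y (nabla Y y u) := by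
  rw [← nablaAlong_id (hA.smoothAt_apply hY), ← nablaAlong_id hY]
  exact (nablaAlong_end (φ := id) hA hY u).trans (by rw [dmap, mfderiv_id]; rfl)

lemma smoothAt_nablaJ (hA : SmoothEnd A) {X : VectorField E M} (hX : ∀ᶠ z in 𝓝 y, SmoothAt X z)
    (hY : SmoothAt Y y) : SmoothAt (fun z ↦ nablaJ A z (Y z) (X z)) y := by
  have hAX : ∀ᶠ z in 𝓝 y, SmoothAt (fun w ↦ A w (X w)) z := hX.mono fun z hz ↦ hA.smoothAt_apply hz
  have hsub : SmoothAt (fun z ↦ nabla (fun w ↦ A w (X w)) z (Y z) - A z (nabla X z (Y z))) y :=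
    (smoothAt_nabla hY hAX).sub_section (hA.smoothAt_apply (smoothAt_nabla hY hX))
  refine SmoothAlongAt.congr (φ := id) hsub ?_
  filter_upwards [hX] with z hz
  rw [nabla_end hA hz, add_sub_cancel_right]

end Endomorphisms

section MetricTrace

variable {V W : Type*} [NormedAddCommGroup V] [InnerProductSpace ℝ V] [AddCommGroup W] [Module ℝ W]
  {ι κ : Type*} [Fintype ι] [Fintype κ]

lemma sum_inner_smul_map (f : OrthonormalBasis ι ℝ V) (a : V →ₗ[ℝ] W) (v : V) :
    ∑ i, inner ℝ v (f i) • a (f i) = a v := by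
  conv_rhs => rw [← f.sum_repr' v]
  simp only [map_sum, map_smul, real_inner_comm]

lemma sum_bilin_orthonormalBasis (b : V →ₗ[ℝ] V →ₗ[ℝ] W) (f : OrthonormalBasis ι ℝ V)
    (g : OrthonormalBasis κ ℝ V) : ∑ i, b (f i) (f i) = ∑ k, b (g k) (g k) := by
  calc ∑ i, b (f i) (f i) = ∑ i, ∑ k, inner ℝ (f i) (g k) • b (g k) (f i) :=
        Finset.sum_congr rfl fun i _ ↦ (sum_inner_smul_map g (b.flip (f i)) (f i)).symm
    _ = ∑ k, ∑ i, inner ℝ (g k) (f i) • b (g k) (f i) := by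
        rw [Finset.sum_comm]
        simp only [real_inner_comm]
    _ = ∑ k, b (g k) (g k) :=
        Finset.sum_congr rfl fun k _ ↦ sum_inner_smul_map f (b (g k)) (g k)

lemma sum_bilin_skew (b : V →ₗ[ℝ] V →ₗ[ℝ] W) (f : OrthonormalBasis ι ℝ V) {w : ι → V}
    (hw : ∀ i j, inner ℝ (w i) (f j) + inner ℝ (f i) (w j) = 0) :
    ∑ i, (b (f i) (w i) + b (w i) (f i)) = 0 := by
  have hright (i : ι) : b (f i) (w i) = ∑ j, inner ℝ (w i) (f j) • b (f i) (f j) :=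
    (sum_inner_smul_map f (b (f i)) (w i)).symm
  have hleft (i : ι) : b (w i) (f i) = ∑ j, inner ℝ (w i) (f j) • b (f j) (f i) :=
    (sum_inner_smul_map f (b.flip (f i)) (w i)).symm
  rw [Finset.sum_add_distrib, Fintype.sum_congr _ _ hright, Fintype.sum_congr _ _ hleft,
    Finset.sum_comm (f := fun i j ↦ inner ℝ (w i) (f j) • b (f j) (f i))]
  simp only [← Finset.sum_add_distrib, ← add_smul]
  refine Finset.sum_eq_zero fun i _ ↦ Finset.sum_eq_zero fun j _ ↦ ?_
  rw [real_inner_comm (f i) (w j), hw, zero_smul]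

/-- The metric contraction `∑ S(f_i, f_j) b(f_i, f_j)` of a bilinear form with a bilinear map. -/
def contraction (f : OrthonormalBasis ι ℝ V) (S : V →ₗ[ℝ] V →ₗ[ℝ] ℝ) (b : V →ₗ[ℝ] V →ₗ[ℝ] W) : W :=
  ∑ i, ∑ j, S (f i) (f j) • b (f i) (f j)

lemma contraction_orthonormalBasis (f : OrthonormalBasis ι ℝ V) (g : OrthonormalBasis κ ℝ V)
    (S : V →ₗ[ℝ] V →ₗ[ℝ] ℝ) (b : V →ₗ[ℝ] V →ₗ[ℝ] W) :
    contraction f S b = contraction g S b := by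
  calc ∑ i, ∑ j, S (f i) (f j) • b (f i) (f j)
      = ∑ i, ∑ l, S (f i) (g l) • b (f i) (g l) := Finset.sum_congr rfl fun i _ ↦
        sum_bilin_orthonormalBasis ((LinearMap.lsmul ℝ W).compl₁₂ (S (f i)) (b (f i))) f g
    _ = ∑ l, ∑ i, S (f i) (g l) • b (f i) (g l) := Finset.sum_comm
    _ = ∑ l, ∑ k, S (g k) (g l) • b (g k) (g l) := Finset.sum_congr rfl fun l _ ↦
        sum_bilin_orthonormalBasis
          ((LinearMap.lsmul ℝ W).compl₁₂ (S.flip (g l)) (b.flip (g l))) f g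
    _ = ∑ k, ∑ l, S (g k) (g l) • b (g k) (g l) := Finset.sum_comm

lemma contraction_add (f : OrthonormalBasis ι ℝ V) (S : V →ₗ[ℝ] V →ₗ[ℝ] ℝ)
    (b c : V →ₗ[ℝ] V →ₗ[ℝ] W) :
    contraction f S (b + c) = contraction f S b + contraction f S c := by
  simp only [contraction, LinearMap.add_apply, smul_add, Finset.sum_add_distrib]

lemma contraction_flip (f : OrthonormalBasis ι ℝ V) {S : V →ₗ[ℝ] V →ₗ[ℝ] ℝ}
    (hS : ∀ u v, S u v = S v u) (b : V →ₗ[ℝ] V →ₗ[ℝ] W) :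
    contraction f S b.flip = contraction f S b := by
  rw [contraction, Finset.sum_comm]
  simp only [contraction, LinearMap.flip_apply, hS]

lemma contraction_compr₂ {W' : Type*} [AddCommGroup W'] [Module ℝ W'] (f : OrthonormalBasis ι ℝ V)
    (S : V →ₗ[ℝ] V →ₗ[ℝ] ℝ) (b : V →ₗ[ℝ] V →ₗ[ℝ] W) (a : W →ₗ[ℝ] W') :
    contraction f S (b.compr₂ a) = a (contraction f S b) := by
  simp only [contraction, LinearMap.compr₂_apply, map_sum, map_smul]

lemma contraction_compl₁₂_isometry (f : OrthonormalBasis ι ℝ V) {S : V →ₗ[ℝ] V →ₗ[ℝ] ℝ}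
    (e : V ≃ₗᵢ[ℝ] V) (hS : ∀ u v, S (e u) (e v) = S u v) (b : V →ₗ[ℝ] V →ₗ[ℝ] W) :
    contraction f S (b.compl₁₂ e.toLinearEquiv.toLinearMap e.toLinearEquiv.toLinearMap)
      = contraction f S b := by
  rw [contraction_orthonormalBasis f (f.map e) S b]
  exact Fintype.sum_congr _ _ fun i ↦ Fintype.sum_congr _ _ fun j ↦
    congrArg (· • b (e (f i)) (e (f j))) (hS (f i) (f j)).symm

/-- The symmetric form `(u, v) ↦ ⟨n u, v⟩ + ⟨n v, u⟩ - ⟨s, u⟩⟨s, v⟩`. For `n = ∇s` it is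
`L_s g - s♭ ⊗ s♭`. -/
def lieDerivForm (n : V →ₗ[ℝ] V) (s : V) : V →ₗ[ℝ] V →ₗ[ℝ] ℝ :=
  (innerₗ V).comp n + ((innerₗ V).comp n).flip
    - (LinearMap.mul ℝ ℝ).compl₁₂ (innerₗ V s) (innerₗ V s)

lemma lieDerivForm_apply (n : V →ₗ[ℝ] V) (s u v : V) :
    lieDerivForm n s u v = inner ℝ (n u) v + inner ℝ (n v) u - inner ℝ s u * inner ℝ s v := rfl

lemma lieDerivForm_comm (n : V →ₗ[ℝ] V) (s u v : V) :
    lieDerivForm n s u v = lieDerivForm n s v u := by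
  rw [lieDerivForm_apply, lieDerivForm_apply, add_comm, mul_comm]

lemma contraction_lieDerivForm (f : OrthonormalBasis ι ℝ V) (n : V →ₗ[ℝ] V) (s : V)
    (b : V →ₗ[ℝ] V →ₗ[ℝ] W) :
    contraction f (lieDerivForm n s) b
      = ∑ i, (b (f i) (n (f i)) + b (n (f i)) (f i)) - b s s := by
  have hright (i : ι) : ∑ j, inner ℝ (n (f i)) (f j) • b (f i) (f j) = b (f i) (n (f i)) :=
    sum_inner_smul_map f (b (f i)) (n (f i))
  have hleft (j : ι) : ∑ i, inner ℝ (n (f j)) (f i) • b (f i) (f j) = b (n (f j)) (f j) :=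
    sum_inner_smul_map f (b.flip (f j)) (n (f j))
  have hs : ∑ i, ∑ j, (inner ℝ s (f i) * inner ℝ s (f j)) • b (f i) (f j) = b s s := by
    simp only [mul_smul, ← Finset.smul_sum, sum_inner_smul_map f (b _)]
    exact sum_inner_smul_map f (b.flip s) s
  simp only [contraction, lieDerivForm_apply, sub_smul, add_smul, Finset.sum_sub_distrib,
    Finset.sum_add_distrib, hright, hs]
  rw [Finset.sum_comm]
  simp only [hleft]

end MetricTrace

section AlmostHermitian

variable {E : Type*} [NormedAddCommGroup E] [NormedSpace ℝ E]
  {M : Type*} [TopologicalSpace M] [ChartedSpace E M] [IsManifold 𝓘(ℝ, E) ∞ M]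
  [RiemannianBundle (fun x : M ↦ TangentSpace 𝓘(ℝ, E) x)]
  {J : EndField E M} {x : M}

lemma IsAlmostHermitian.smoothEnd (hJ : IsAlmostHermitian J) : SmoothEnd J :=
  hJ.smooth

lemma IsAlmostHermitian.inner_apply (hJ : IsAlmostHermitian J) (v w : TangentSpace 𝓘(ℝ, E) x) :
    inner ℝ (J x v) w = -inner ℝ v (J x w) := by
  rw [← hJ.isometry x (J x v) w, hJ.sq_eq_neg, inner_neg_left]

/-- The vector `u - i J u` of `T'M`; every element of `T'M` has this form. -/
def toT' (J : EndField E M) (u : TangentSpace 𝓘(ℝ, E) x) : CTangent (E := E) x := (u, -J x u)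

/-- The vector `u + i J u` of `T''M`; every element of `T''M` has this form. -/
def toT'' (J : EndField E M) (u : TangentSpace 𝓘(ℝ, E) x) : CTangent (E := E) x := (u, J x u)

lemma memT'_toT' (hJ : IsAlmostHermitian J) (u : TangentSpace 𝓘(ℝ, E) x) : MemT' J (toT' J u) := by
  simp only [MemT', toT', complexJ, mulI, map_neg, hJ.sq_eq_neg, neg_neg]

lemma memT''_toT'' (hJ : IsAlmostHermitian J) (u : TangentSpace 𝓘(ℝ, E) x) :
    MemT'' J (toT'' J u) := by
  simp only [MemT'', toT'', complexJ, mulI, hJ.sq_eq_neg, Prod.neg_mk, neg_neg]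

variable [FiniteDimensional ℝ E]

/-- `J` at a point as a linear isometry. -/
def IsAlmostHermitian.isometryEquiv (hJ : IsAlmostHermitian J) (x : M) :
    TangentSpace 𝓘(ℝ, E) x ≃ₗᵢ[ℝ] TangentSpace 𝓘(ℝ, E) x :=
  ((J x).toLinearMap.isometryOfInner (hJ.isometry x)).toLinearIsometryEquiv rfl

variable [IsContMDiffRiemannianBundle 𝓘(ℝ, E) ∞ E (fun x : M ↦ TangentSpace 𝓘(ℝ, E) x)]

lemma nablaJ_end (hJ : IsAlmostHermitian J) (u v : TangentSpace 𝓘(ℝ, E) x) :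
    nablaJ J x u (J x v) = -J x (nablaJ J x u v) := by
  have hv := smoothAt_localExt v (mem_chart_source E x)
  have hleibniz := nabla_end hJ.smoothEnd (hJ.smoothEnd.smoothAt_apply hv) u
  simp only [hJ.sq_eq_neg] at hleibniz
  rw [nabla_neg hv, nabla_end hJ.smoothEnd hv, map_add, hJ.sq_eq_neg, localExt_self] at hleibniz
  rw [eq_sub_of_add_eq hleibniz.symm]
  abel

lemma inner_nablaJ_end (hJ : IsAlmostHermitian J) (u v w : TangentSpace 𝓘(ℝ, E) x) :
    inner ℝ v (nablaJ J x u (J x w)) = inner ℝ (J x v) (nablaJ J x u w) := by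
  rw [nablaJ_end hJ, inner_neg_right, hJ.inner_apply]

lemma mvfderiv_fundamentalForm (hJ : IsAlmostHermitian J) (u v w : TangentSpace 𝓘(ℝ, E) x) :
    mvfderiv 𝓘(ℝ, E) (fun y ↦ fundamentalForm J y (localExt v y) (localExt w y)) x u
      = inner ℝ (nabla (localExt v) x u) (J x w) + inner ℝ v (nablaJ J x u w)
        - inner ℝ (J x v) (nabla (localExt w) x u) := by
  have hx := mem_chart_source E x
  have hw := smoothAt_localExt w hx
  simp only [fundamentalForm]
  rw [mvfderiv_inner (smoothAt_localExt v hx) (hJ.smoothEnd.smoothAt_apply hw),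
    nabla_end hJ.smoothEnd hw, localExt_self, localExt_self, inner_add_right, hJ.inner_apply v]
  ring

lemma dFundamentalForm_eq (hJ : IsAlmostHermitian J) (u v w : TangentSpace 𝓘(ℝ, E) x) :
    dFundamentalForm J x u v w
      = inner ℝ v (nablaJ J x u w) - inner ℝ u (nablaJ J x v w) + inner ℝ u (nablaJ J x w v) := by
  rw [dFundamentalForm, mvfderiv_fundamentalForm hJ, mvfderiv_fundamentalForm hJ,
    mvfderiv_fundamentalForm hJ, mlieBracket_localExt, mlieBracket_localExt, mlieBracket_localExt,
    nabla_localExt_comm v u, nabla_localExt_comm w u, nabla_localExt_comm w v,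
    real_inner_comm (nabla (localExt w) x u) (J x v)]
  simp only [fundamentalForm, inner_zero_left]
  ring

/-- The tensor `J (∇_u J) v + (∇_{J u} J) v`, which vanishes on `(1,2)`-symplectic manifolds. -/
def quasiKaehler (hJ : IsAlmostHermitian J) (x : M) :
    TangentSpace 𝓘(ℝ, E) x →ₗ[ℝ] TangentSpace 𝓘(ℝ, E) x →ₗ[ℝ] TangentSpace 𝓘(ℝ, E) x :=
  (nablaJBilin hJ.smoothEnd x).compr₂ (J x).toLinearMap
    + (nablaJBilin hJ.smoothEnd x).comp (J x).toLinearMap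

lemma quasiKaehler_apply (hJ : IsAlmostHermitian J) (u v : TangentSpace 𝓘(ℝ, E) x) :
    quasiKaehler hJ x u v = J x (nablaJ J x u v) + nablaJ J x (J x u) v := by
  rw [← nablaJBilin_apply hJ.smoothEnd, ← nablaJBilin_apply hJ.smoothEnd]
  rfl

lemma nablaJ_neg_left (hJ : IsAlmostHermitian J) (u v : TangentSpace 𝓘(ℝ, E) x) :
    nablaJ J x (-u) v = -nablaJ J x u v := by
  rw [← nablaJBilin_apply hJ.smoothEnd, ← nablaJBilin_apply hJ.smoothEnd, map_neg,
    LinearMap.neg_apply]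

lemma quasiKaehler_end_left (hJ : IsAlmostHermitian J) (u v : TangentSpace 𝓘(ℝ, E) x) :
    quasiKaehler hJ x (J x u) v = J x (quasiKaehler hJ x u v) := by
  rw [quasiKaehler_apply, quasiKaehler_apply, hJ.sq_eq_neg, nablaJ_neg_left hJ, map_add,
    hJ.sq_eq_neg, add_comm]

lemma quasiKaehler_end_right (hJ : IsAlmostHermitian J) (u v : TangentSpace 𝓘(ℝ, E) x) :
    quasiKaehler hJ x u (J x v) = -J x (quasiKaehler hJ x u v) := by
  rw [quasiKaehler_apply, quasiKaehler_apply, nablaJ_end hJ, nablaJ_end hJ, map_add, map_neg,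
    neg_add]

lemma sum_quasiKaehler (hJ : IsAlmostHermitian J) (x : M) :
    ∑ i, quasiKaehler hJ x (onb x i) (onb x i) = (2 : ℝ) • sigma J x := by
  have hterm (u : TangentSpace 𝓘(ℝ, E) x) :
      nablaJ J x (J x (J x u)) (J x u) = J x (nablaJ J x u u) := by
    rw [hJ.sq_eq_neg, nablaJ_neg_left hJ, nablaJ_end hJ, neg_neg]
  have hsum : ∑ i, nablaJ J x (J x (onb x i)) (onb x i) = sigma J x := by
    calc ∑ i, nablaJ J x (J x (onb x i)) (onb x i)
        = ∑ i, nablaJ J x (J x (J x (onb x i))) (J x (onb x i)) := by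
          simp only [← nablaJBilin_apply hJ.smoothEnd]
          exact sum_bilin_orthonormalBasis ((nablaJBilin hJ.smoothEnd x).comp (J x).toLinearMap)
            (onb x) ((onb x).map (hJ.isometryEquiv x))
      _ = sigma J x := by simp only [hterm, sigma, divJ, map_sum]
  simp only [quasiKaehler_apply, Finset.sum_add_distrib, hsum]
  rw [← map_sum, two_smul]
  rfl

theorem IsOneTwoSymplectic.quasiKaehler_eq_zero (hJ : IsAlmostHermitian J)
    (h : IsOneTwoSymplectic J) (u v : TangentSpace 𝓘(ℝ, E) x) : quasiKaehler hJ x u v = 0 := by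
  have hneg (a b c : TangentSpace 𝓘(ℝ, E) x) :
      inner ℝ c (nablaJ J x a (-b)) = -inner ℝ c (nablaJ J x a b) := by
    rw [← nablaJBilin_apply hJ.smoothEnd, ← nablaJBilin_apply hJ.smoothEnd, map_neg,
      inner_neg_right]
  refine ext_inner_left ℝ fun w ↦ ?_
  have hdΩ := congrArg Complex.re
    (h x _ _ _ (memT'_toT' hJ u) (memT''_toT'' hJ (J x w)) (memT''_toT'' hJ v))
  simp only [toT', toT'', complexDFundamentalForm, Complex.zero_re, dFundamentalForm_eq hJ,
    hJ.sq_eq_neg, nablaJ_neg_left hJ, inner_nablaJ_end hJ, hneg, inner_neg_left,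
    inner_neg_right, map_neg, neg_neg] at hdΩ
  rw [quasiKaehler_apply, inner_zero_right, inner_add_right]
  linarith [hJ.inner_apply w (nablaJ J x u v)]

end AlmostHermitian

section Holomorphic

variable {E : Type*} [NormedAddCommGroup E] [NormedSpace ℝ E] [FiniteDimensional ℝ E]
  {M : Type*} [TopologicalSpace M] [ChartedSpace E M] [IsManifold 𝓘(ℝ, E) ∞ M]
  [RiemannianBundle (fun x : M ↦ TangentSpace 𝓘(ℝ, E) x)]
  [IsContMDiffRiemannianBundle 𝓘(ℝ, E) ∞ E (fun x : M ↦ TangentSpace 𝓘(ℝ, E) x)]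
  {F : Type*} [NormedAddCommGroup F] [NormedSpace ℝ F] [FiniteDimensional ℝ F]
  {N : Type*} [TopologicalSpace N] [ChartedSpace F N] [IsManifold 𝓘(ℝ, F) ∞ N]
  [RiemannianBundle (fun p : N ↦ TangentSpace 𝓘(ℝ, F) p)]
  [IsContMDiffRiemannianBundle 𝓘(ℝ, F) ∞ F (fun p : N ↦ TangentSpace 𝓘(ℝ, F) p)]
  {φ : M → N} {J : EndField E M} {JN : EndField F N} {x : M}

lemma secondFundamentalForm_end (hJ : IsAlmostHermitian J) (hJN : IsAlmostHermitian JN)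
    (hφ : IsHolomorphic J JN φ) (u v : TangentSpace 𝓘(ℝ, E) x) :
    secondFundamentalForm φ x u (J x v)
      = JN (φ x) (secondFundamentalForm φ x u v)
        + nablaJ JN (φ x) (dmap E F φ x u) (dmap E F φ x v) - dmap E F φ x (nablaJ J x u v) := by
  have hv := smoothAt_localExt v (mem_chart_source E x)
  have hleft := nablaAlong_dmap hφ.smooth (hJ.smoothEnd.smoothAt_apply hv) u
  have hright := nablaAlong_end hJN.smoothEnd (hv.smoothAlongAt_dmap hφ.smooth) u
  simp only [hφ.commutes] at hleft
  rw [hright, nablaAlong_dmap hφ.smooth hv, nabla_end hJ.smoothEnd hv, localExt_self, map_add,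
    map_add, hφ.commutes x (nabla _ x u)] at hleft
  rw [eq_sub_of_add_eq hleft.symm]
  abel

lemma secondFundamentalForm_add_end (hJ : IsAlmostHermitian J) (hJN : IsAlmostHermitian JN)
    (hφ : IsHolomorphic J JN φ) (u v : TangentSpace 𝓘(ℝ, E) x) :
    secondFundamentalForm φ x u v + secondFundamentalForm φ x (J x u) (J x v)
      = JN (φ x) (secondFundamentalForm φ x (J x u) v - secondFundamentalForm φ x u (J x v))
        + quasiKaehler hJN (φ x) (dmap E F φ x u) (dmap E F φ x v)
        - dmap E F φ x (quasiKaehler hJ x u v) := by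
  rw [map_sub, secondFundamentalForm_end hJ hJN hφ u v,
    secondFundamentalForm_end hJ hJN hφ (J x u) v, quasiKaehler_apply, quasiKaehler_apply, map_sub,
    map_add, map_add, hJN.sq_eq_neg, hφ.commutes x u, hφ.commutes x (nablaJ J x u v)]
  abel

theorem IsOneTwoSymplectic.secondFundamentalForm_add_end (hN : IsOneTwoSymplectic JN)
    (hJ : IsAlmostHermitian J) (hJN : IsAlmostHermitian JN) (hφ : IsHolomorphic J JN φ)
    (u v : TangentSpace 𝓘(ℝ, E) x) :
    (2 : ℝ) • (secondFundamentalForm φ x u v + secondFundamentalForm φ x (J x u) (J x v))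
      = -dmap E F φ x (quasiKaehler hJ x u v + quasiKaehler hJ x v u) := by
  have huv := BiharmonicHolomorphic.secondFundamentalForm_add_end hJ hJN hφ u v
  have hvu := BiharmonicHolomorphic.secondFundamentalForm_add_end hJ hJN hφ v u
  rw [hN.quasiKaehler_eq_zero hJN, map_sub] at huv hvu
  rw [secondFundamentalForm_comm hφ.smooth v u, secondFundamentalForm_comm hφ.smooth (J x v) u,
    secondFundamentalForm_comm hφ.smooth v (J x u),
    secondFundamentalForm_comm hφ.smooth (J x v) (J x u)] at hvu
  rw [two_smul]
  nth_rewrite 1 [huv]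
  rw [hvu, map_add]
  abel

theorem IsOneTwoSymplectic.tension_eq (hN : IsOneTwoSymplectic JN) (hJ : IsAlmostHermitian J)
    (hJN : IsAlmostHermitian JN) (hφ : IsHolomorphic J JN φ) (x : M) :
    tension E F φ x = -dmap E F φ x (sigma J x) := by
  have hinv : tension E F φ x
      = ∑ i, secondFundamentalForm φ x (J x (onb x i)) (J x (onb x i)) :=
    sum_bilin_orthonormalBasis (sffBilin hφ.smooth x) (onb x) ((onb x).map (hJ.isometryEquiv x))
  refine smul_right_injective _ (show (4 : ℝ) ≠ 0 by norm_num) ?_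
  calc (4 : ℝ) • tension E F φ x
      = (2 : ℝ) • (tension E F φ x + tension E F φ x) := by module
    _ = ∑ i, (2 : ℝ) • (secondFundamentalForm φ x (onb x i) (onb x i)
          + secondFundamentalForm φ x (J x (onb x i)) (J x (onb x i))) := by
        nth_rewrite 2 [hinv]
        rw [tension, ← Finset.sum_add_distrib, Finset.smul_sum]
    _ = -dmap E F φ x (∑ i, quasiKaehler hJ x (onb x i) (onb x i)
          + ∑ i, quasiKaehler hJ x (onb x i) (onb x i)) := by
        simp only [hN.secondFundamentalForm_add_end hJ hJN hφ, Finset.sum_neg_distrib, ← map_sum,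
          Finset.sum_add_distrib]
    _ = (4 : ℝ) • -dmap E F φ x (sigma J x) := by
        rw [sum_quasiKaehler, map_add, map_smul]
        module

end Holomorphic

section Frame

variable {E : Type*} [NormedAddCommGroup E] [NormedSpace ℝ E] [FiniteDimensional ℝ E]
  {M : Type*} [TopologicalSpace M] [ChartedSpace E M] [IsManifold 𝓘(ℝ, E) ∞ M]
  [RiemannianBundle (fun x : M ↦ TangentSpace 𝓘(ℝ, E) x)]
  {x : M} {J : EndField E M}

/-- `f` is an orthonormal frame of smooth vector fields near `x`. -/
def IsOrthonormalFrameAt {ι : Type*} [Fintype ι] (f : ι → VectorField E M) (x : M) : Prop :=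
  ∀ᶠ y in 𝓝 x, (∀ i, SmoothAt (f i) y) ∧
    ∃ b : OrthonormalBasis ι ℝ (TangentSpace 𝓘(ℝ, E) y), ∀ i, b i = f i y

/-- The frame `e₁, …, eₙ, J e₁, …, J eₙ`. -/
def adaptedFrame (J : EndField E M) {n : ℕ} (e : Fin n → VectorField E M) :
    Fin n ⊕ Fin n → VectorField E M :=
  Sum.elim e fun j y ↦ J y (e j y)

omit [FiniteDimensional ℝ E] in
lemma IsAdaptedFrameOn.smoothAt {n : ℕ} {e : Fin n → VectorField E M} {U : Set M}
    (he : IsAdaptedFrameOn J e U) (hU : IsOpen U) {y : M} (hy : y ∈ U) (j : Fin n) :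
    SmoothAt (e j) y :=
  (he.smooth j).contMDiffAt (hU.mem_nhds hy)

lemma IsAdaptedFrameOn.isOrthonormalFrameAt {n : ℕ} {e : Fin n → VectorField E M} {U : Set M}
    (he : IsAdaptedFrameOn J e U) (hJ : SmoothEnd J) (hU : IsOpen U) (hx : x ∈ U) :
    IsOrthonormalFrameAt (adaptedFrame J e) x := by
  filter_upwards [hU.mem_nhds hx] with y hy
  constructor
  · rintro (j | j)
    · exact he.smoothAt hU hy j
    · exact hJ.smoothAt_apply (he.smoothAt hU hy j)
  · have horth := he.orthonormal y hy
    have hcard : Fintype.card (Fin n ⊕ Fin n) = Module.finrank ℝ (TangentSpace 𝓘(ℝ, E) y) := by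
      rw [Fintype.card_sum, Fintype.card_fin, ← two_mul]
      exact he.card
    refine ⟨.mk horth (horth.linearIndependent.span_eq_top_of_card_eq_finrank' hcard).ge, ?_⟩
    rintro (j | j) <;> rw [OrthonormalBasis.coe_mk] <;> rfl

variable {ι : Type*} [Fintype ι] {f : ι → VectorField E M}

omit [FiniteDimensional ℝ E] in
lemma IsOrthonormalFrameAt.eventually_smoothAt (hf : IsOrthonormalFrameAt f x) (i : ι) :
    ∀ᶠ y in 𝓝 x, SmoothAt (f i) y :=
  hf.mono fun _ hy ↦ hy.1 i

lemma IsOrthonormalFrameAt.sum_bilin (hf : IsOrthonormalFrameAt f x) {W : Type*} [AddCommGroup W]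
    [Module ℝ W] (b : TangentSpace 𝓘(ℝ, E) x →ₗ[ℝ] TangentSpace 𝓘(ℝ, E) x →ₗ[ℝ] W) :
    ∑ i, b (onb x i) (onb x i) = ∑ i, b (f i x) (f i x) := by
  obtain ⟨-, g, hg⟩ := hf.self_of_nhds
  simp only [← hg]
  exact sum_bilin_orthonormalBasis b (onb x) g

variable [IsContMDiffRiemannianBundle 𝓘(ℝ, E) ∞ E (fun x : M ↦ TangentSpace 𝓘(ℝ, E) x)]

lemma IsOrthonormalFrameAt.smoothAt_divJ (hf : IsOrthonormalFrameAt f x) (hJ : SmoothEnd J) :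
    SmoothAt (divJ J) x := by
  have hsum : SmoothAt (fun y ↦ ∑ i, nablaJ J y (f i y) (f i y)) x :=
    ContMDiffAt.sum_section fun i _ ↦
      smoothAt_nablaJ hJ (hf.eventually_smoothAt i) (hf.eventually_smoothAt i).self_of_nhds
  refine SmoothAlongAt.congr (φ := id) hsum ?_
  filter_upwards [hf.eventually_nhds] with y (hy : IsOrthonormalFrameAt f y)
  simp only [divJ, ← nablaJBilin_apply hJ]
  exact hy.sum_bilin (nablaJBilin hJ y)

lemma IsOrthonormalFrameAt.inner_nabla (hf : IsOrthonormalFrameAt f x)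
    (u : TangentSpace 𝓘(ℝ, E) x) (i j : ι) :
    inner ℝ (nabla (f i) x u) (f j x) + inner ℝ (f i x) (nabla (f j) x u) = 0 := by
  classical
  have hconst : (fun y ↦ inner ℝ (f i y) (f j y)) =ᶠ[𝓝 x]
      fun _ ↦ if i = j then (1 : ℝ) else 0 := by
    filter_upwards [hf] with y ⟨_, b, hb⟩
    rw [← hb, ← hb, orthonormal_iff_ite.mp b.orthonormal]
  rw [← mvfderiv_inner (hf.eventually_smoothAt i).self_of_nhds
    (hf.eventually_smoothAt j).self_of_nhds, mvfderiv, hconst.mfderiv_eq, mfderiv_const]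
  rfl

lemma IsOrthonormalFrameAt.sum_bilin_nabla (hf : IsOrthonormalFrameAt f x)
    {W : Type*} [AddCommGroup W] [Module ℝ W]
    (b : TangentSpace 𝓘(ℝ, E) x →ₗ[ℝ] TangentSpace 𝓘(ℝ, E) x →ₗ[ℝ] W)
    (u : TangentSpace 𝓘(ℝ, E) x) :
    ∑ i, (b (f i x) (nabla (f i) x u) + b (nabla (f i) x u) (f i x)) = 0 := by
  obtain ⟨-, g, hg⟩ := hf.self_of_nhds
  simp only [← hg]
  refine sum_bilin_skew b g fun i j ↦ ?_
  rw [hg, hg]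
  exact hf.inner_nabla u i j

lemma IsOrthonormalFrameAt.roughLaplacian_eq (hf : IsOrthonormalFrameAt f x)
    {ξ : VectorField E M} (hξ : ∀ᶠ y in 𝓝 x, SmoothAt ξ y) :
    roughLaplacian ξ x = ∑ i, secondCovDeriv ξ x (f i x) (f i x) := by
  change ∑ i, secondCovDeriv ξ x (onb x i) (onb x i) = _
  simp only [← nablaHom_nablaAlong_id hξ]
  exact hf.sum_bilin (isHomRepAt_nablaAlong (φ := id) hξ).nablaHomBilin

lemma IsOrthonormalFrameAt.ricci_eq (hf : IsOrthonormalFrameAt f x)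
    (v : TangentSpace 𝓘(ℝ, E) x) : ricci x v = ∑ i, curvature x v (f i x) (f i x) :=
  hf.sum_bilin (curvatureBilin x v)

variable {F : Type*} [NormedAddCommGroup F] [NormedSpace ℝ F] [FiniteDimensional ℝ F]
  {N : Type*} [TopologicalSpace N] [ChartedSpace F N] [IsManifold 𝓘(ℝ, F) ∞ N]
  [RiemannianBundle (fun p : N ↦ TangentSpace 𝓘(ℝ, F) p)]
  [IsContMDiffRiemannianBundle 𝓘(ℝ, F) ∞ F (fun p : N ↦ TangentSpace 𝓘(ℝ, F) p)]
  {φ : M → N} {V : Π x : M, TangentSpace 𝓘(ℝ, F) (φ x)} {ξ : VectorField E M}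

lemma IsOrthonormalFrameAt.roughLaplacianAlong_eq (hf : IsOrthonormalFrameAt f x)
    (hV : ∀ᶠ y in 𝓝 x, SmoothAlongAt E φ V y) :
    roughLaplacianAlong E φ V x = ∑ i, nablaHom φ (nablaAlong φ V) x (f i x) (f i x) :=
  hf.sum_bilin (isHomRepAt_nablaAlong hV).nablaHomBilin

omit [IsContMDiffRiemannianBundle 𝓘(ℝ, E) ∞ E (fun x : M ↦ TangentSpace 𝓘(ℝ, E) x)] in
lemma IsOrthonormalFrameAt.ricciAlong_eq (hf : IsOrthonormalFrameAt f x)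
    (v : TangentSpace 𝓘(ℝ, F) (φ x)) :
    ricciAlong E φ x v
      = ∑ i, curvature (φ x) v (dmap E F φ x (f i x)) (dmap E F φ x (f i x)) :=
  hf.sum_bilin ((curvatureBilin (φ x) v).compl₁₂ (dmap E F φ x).toLinearMap
    (dmap E F φ x).toLinearMap)

lemma IsOrthonormalFrameAt.tension_eq (hf : IsOrthonormalFrameAt f x)
    (hφ : ContMDiff 𝓘(ℝ, E) 𝓘(ℝ, F) ∞ φ) :
    tension E F φ x = ∑ i, secondFundamentalForm φ x (f i x) (f i x) :=
  hf.sum_bilin (sffBilin hφ x)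

lemma IsOrthonormalFrameAt.nablaAlong_tension (hf : IsOrthonormalFrameAt f x)
    (hφ : ContMDiff 𝓘(ℝ, E) 𝓘(ℝ, F) ∞ φ) (u : TangentSpace 𝓘(ℝ, E) x) :
    nablaAlong φ (tension E F φ) x u
      = ∑ i, nablaAlong φ (fun y ↦ secondFundamentalForm φ y (f i y) (f i y)) x u := by
  have hsff (i : ι) : SmoothAlongAt E φ
      (fun y ↦ secondFundamentalForm (F := F) φ y (f i y) (f i y)) x :=
    smoothAlongAt_secondFundamentalForm hφ (hf.eventually_smoothAt i).self_of_nhds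
      (hf.eventually_smoothAt i)
  have htension : ∀ᶠ y in 𝓝 x, tension E F φ y
      = ∑ i, secondFundamentalForm φ y (f i y) (f i y) := by
    filter_upwards [hf.eventually_nhds] with y (hy : IsOrthonormalFrameAt f y)
    exact hy.tension_eq hφ
  rw [nablaAlong_congr htension, nablaAlong_sum (hφ x) hsff]

theorem IsOrthonormalFrameAt.roughLaplacianAlong_dmap_add_ricciAlong
    (hf : IsOrthonormalFrameAt f x) (hφ : ContMDiff 𝓘(ℝ, E) 𝓘(ℝ, F) ∞ φ)
    (hξ : ∀ᶠ y in 𝓝 x, SmoothAt ξ y) :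
    roughLaplacianAlong E φ (fun y ↦ dmap E F φ y (ξ y)) x
        + ricciAlong E φ x (dmap E F φ x (ξ x))
      = dmap E F φ x (roughLaplacian ξ x + ricci x (ξ x)) + nablaAlong φ (tension E F φ) x (ξ x)
        + ∑ i, (secondFundamentalForm φ x (f i x) (nabla ξ x (f i x))
          + secondFundamentalForm φ x (nabla ξ x (f i x)) (f i x)) := by
  have hdξ : ∀ᶠ y in 𝓝 x, SmoothAlongAt E φ (fun z ↦ dmap E F φ z (ξ z)) y :=
    hξ.mono fun y hy ↦ hy.smoothAlongAt_dmap hφ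
  have hskew := hf.sum_bilin_nabla (sffBilin hφ x) (ξ x)
  simp only [sffBilin_apply] at hskew
  rw [hf.roughLaplacianAlong_eq hdξ, hf.ricciAlong_eq, ← Finset.sum_add_distrib]
  simp only [nablaHom_nablaAlong_dmap_add_curvature hφ hξ (hf.eventually_smoothAt _)]
  rw [Finset.sum_sub_distrib, hskew, sub_zero, Finset.sum_add_distrib, Finset.sum_add_distrib,
    ← map_sum, Finset.sum_add_distrib, ← hf.roughLaplacian_eq hξ, ← hf.ricci_eq,
    ← hf.nablaAlong_tension hφ]

end Frame

section Bitension

variable {E : Type*} [NormedAddCommGroup E] [NormedSpace ℝ E] [FiniteDimensional ℝ E]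
  {M : Type*} [TopologicalSpace M] [ChartedSpace E M] [IsManifold 𝓘(ℝ, E) ∞ M]
  [RiemannianBundle (fun x : M ↦ TangentSpace 𝓘(ℝ, E) x)]
  [IsContMDiffRiemannianBundle 𝓘(ℝ, E) ∞ E (fun x : M ↦ TangentSpace 𝓘(ℝ, E) x)]
  {x : M} {ξ : VectorField E M}

/-- `∇ξ` at a point as an endomorphism. -/
def nablaLinear (hξ : SmoothAt ξ x) : TangentSpace 𝓘(ℝ, E) x →ₗ[ℝ] TangentSpace 𝓘(ℝ, E) x where
  toFun := nabla ξ x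
  map_add' u v := toCoord_injective (mem_chart_source E x) (by
    simp only [toCoord_nabla (mem_chart_source E x) hξ, map_add, _root_.add_apply]; abel)
  map_smul' c u := toCoord_injective (mem_chart_source E x) (by
    simp only [toCoord_nabla (mem_chart_source E x) hξ, map_smul, _root_.smul_apply, smul_add,
      RingHom.id_apply])

lemma nablaLinear_apply (hξ : SmoothAt ξ x) (u : TangentSpace 𝓘(ℝ, E) x) :
    nablaLinear hξ u = nabla ξ x u := rfl

variable {F : Type*} [NormedAddCommGroup F] [NormedSpace ℝ F] [FiniteDimensional ℝ F]
  {N : Type*} [TopologicalSpace N] [ChartedSpace F N] [IsManifold 𝓘(ℝ, F) ∞ N]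
  [RiemannianBundle (fun p : N ↦ TangentSpace 𝓘(ℝ, F) p)]
  [IsContMDiffRiemannianBundle 𝓘(ℝ, F) ∞ F (fun p : N ↦ TangentSpace 𝓘(ℝ, F) p)]
  {φ : M → N} {ι : Type*} [Fintype ι] {f : ι → VectorField E M}

omit [IsContMDiffRiemannianBundle 𝓘(ℝ, E) ∞ E (fun x : M ↦ TangentSpace 𝓘(ℝ, E) x)] in
lemma roughLaplacianAlong_neg {V : Π x : M, TangentSpace 𝓘(ℝ, F) (φ x)}
    (hV : ∀ᶠ y in 𝓝 x, SmoothAlongAt E φ V y) :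
    roughLaplacianAlong E φ (fun y ↦ -V y) x = -roughLaplacianAlong E φ V x := by
  simp only [roughLaplacianAlong, ← Finset.sum_neg_distrib]
  refine Finset.sum_congr rfl fun i _ ↦ ?_
  have hVy : SmoothAlongAt E φ V x := hV.self_of_nhds
  rw [nablaAlong_congr (hV.mono fun y hy ↦ nablaAlong_neg hy _), nablaAlong_neg
    (smoothAlongAt_nablaAlong hV (smoothAt_localExt _ (mem_chart_source E x))), nablaAlong_neg hVy]
  abel

omit [IsManifold 𝓘(ℝ, E) ∞ M]
  [IsContMDiffRiemannianBundle 𝓘(ℝ, E) ∞ E (fun x : M ↦ TangentSpace 𝓘(ℝ, E) x)] in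
lemma ricciAlong_neg (v : TangentSpace 𝓘(ℝ, F) (φ x)) :
    ricciAlong E φ x (-v) = -ricciAlong E φ x v := by
  simp only [ricciAlong, curvature_neg_left, Finset.sum_neg_distrib]

theorem IsOrthonormalFrameAt.bitension_eq (hf : IsOrthonormalFrameAt f x)
    (hφ : ContMDiff 𝓘(ℝ, E) 𝓘(ℝ, F) ∞ φ) (hξ : ∀ᶠ y in 𝓝 x, SmoothAt ξ y)
    (hτ : ∀ y, tension E F φ y = -dmap E F φ y (ξ y)) :
    bitension E F φ x
      = -(dmap E F φ x (roughLaplacian ξ x + ricci x (ξ x) - nabla ξ x (ξ x))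
        + contraction (onb x) (lieDerivForm (nablaLinear hξ.self_of_nhds) (ξ x))
          (sffBilin hφ x)) := by
  obtain ⟨-, b, hb⟩ := hf.self_of_nhds
  have hdξ : ∀ᶠ y in 𝓝 x, SmoothAlongAt E φ (fun z ↦ dmap E F φ z (ξ z)) y :=
    hξ.mono fun y hy ↦ hy.smoothAlongAt_dmap hφ
  have hdξx : SmoothAlongAt E φ (fun z ↦ dmap E F φ z (ξ z)) x := hdξ.self_of_nhds
  have hjacobi := hf.roughLaplacianAlong_dmap_add_ricciAlong hφ hξ
  rw [funext hτ, nablaAlong_neg hdξx, nablaAlong_dmap hφ hξ.self_of_nhds] at hjacobi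
  rw [bitension, funext hτ, roughLaplacianAlong_neg hdξ, ricciAlong_neg, ← neg_add, hjacobi,
    contraction_orthonormalBasis (onb x) b, contraction_lieDerivForm]
  simp only [nablaLinear_apply, sffBilin_apply, hb, map_sub]
  abel

end Bitension

section ComplexTangent

variable {E : Type*} [NormedAddCommGroup E] [NormedSpace ℝ E]
  {M : Type*} [TopologicalSpace M] [ChartedSpace E M]
  {x : M} {J : EndField E M}

/-- Twice the real part of the `T'M`-component of a complex tangent vector. -/
def twiceRePart' (J : EndField E M) (x : M) : CTangent (E := E) x →ₗ[ℝ] TangentSpace 𝓘(ℝ, E) x :=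
  LinearMap.fst ℝ _ _ + (J x).toLinearMap ∘ₗ LinearMap.snd ℝ _ _

lemma twiceRePart'_mk (a b : TangentSpace 𝓘(ℝ, E) x) : twiceRePart' J x (a, b) = a + J x b := rfl

lemma twiceRePart'_eq_zero {z : CTangent (E := E) x} (h : part' J z = 0) :
    twiceRePart' J x z = 0 := by
  have hfst : (1 / 2 : ℝ) • (z.1 - -J x z.2) = 0 := congrArg Prod.fst h
  have hsum := (smul_eq_zero.mp hfst).resolve_left (by norm_num)
  rwa [sub_neg_eq_add] at hsum

lemma hermitianVector_eq_toT' (J : EndField E M) (e : VectorField E M) (y : M) :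
    hermitianVector J e y = toT' J ((√2)⁻¹ • e y) := by
  refine Prod.ext ?_ ?_
  · change (√2)⁻¹ • (e y - -0) = (√2)⁻¹ • e y
    rw [neg_zero, sub_zero]
  · change (√2)⁻¹ • (0 - J y (e y)) = -J y ((√2)⁻¹ • e y)
    rw [map_smul, zero_sub, smul_neg]

lemma cconj_hermitianVector (J : EndField E M) (e : VectorField E M) (y : M) :
    cconj (hermitianVector J e y) = toT'' J ((√2)⁻¹ • e y) := by
  rw [hermitianVector_eq_toT', cconj, toT', toT'', neg_neg]

variable [IsManifold 𝓘(ℝ, E) ∞ M] [RiemannianBundle (fun x : M ↦ TangentSpace 𝓘(ℝ, E) x)]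

lemma part'_eq_toT' (hJ : IsAlmostHermitian J) (z : CTangent (E := E) x) :
    part' J z = toT' J ((1 / 2 : ℝ) • (z.1 + J x z.2)) := by
  refine Prod.ext ?_ ?_
  · change (1 / 2 : ℝ) • (z.1 - -J x z.2) = _
    rw [sub_neg_eq_add]
    rfl
  · change (1 / 2 : ℝ) • (z.2 - J x z.1) = -J x ((1 / 2 : ℝ) • (z.1 + J x z.2))
    rw [map_smul, map_add, hJ.sq_eq_neg]
    module

lemma part''_eq_toT'' (hJ : IsAlmostHermitian J) (z : CTangent (E := E) x) :
    part'' J z = toT'' J ((1 / 2 : ℝ) • (z.1 - J x z.2)) := by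
  refine Prod.ext ?_ ?_
  · change (1 / 2 : ℝ) • (z.1 + -J x z.2) = _
    rw [← sub_eq_add_neg]
    rfl
  · change (1 / 2 : ℝ) • (z.2 + J x z.1) = J x ((1 / 2 : ℝ) • (z.1 - J x z.2))
    rw [map_smul, map_sub, hJ.sq_eq_neg]
    module

variable [FiniteDimensional ℝ E]
  [IsContMDiffRiemannianBundle 𝓘(ℝ, E) ∞ E (fun x : M ↦ TangentSpace 𝓘(ℝ, E) x)]

lemma nabla_zero (u : TangentSpace 𝓘(ℝ, E) x) : nabla (fun _ : M ↦ 0) x u = 0 := by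
  simpa only [zero_smul] using
    nabla_const_smul (smoothAt_localExt 0 (mem_chart_source E x)) 0 u

lemma cnabla_ofReal (Y : VectorField E M) (z : CTangent (E := E) x) :
    cnabla (fun y ↦ ofReal (Y y)) x z = (nabla Y x z.1, nabla Y x z.2) := by
  simp only [cnabla, ofReal, nabla_zero, sub_zero, zero_add]

lemma twiceRePart'_cnabla_toT'' (hJ : IsAlmostHermitian J) {X : VectorField E M}
    (hX : SmoothAt X x) (u : TangentSpace 𝓘(ℝ, E) x) :
    twiceRePart' J x (cnabla (fun y ↦ toT'' J (X y)) x (toT' J u)) = quasiKaehler hJ x u (X x) := by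
  have hneg (v : TangentSpace 𝓘(ℝ, E) x) : nabla X x (-v) = -nabla X x v :=
    map_neg (nablaLinear hX) v
  rw [cnabla, twiceRePart'_mk, quasiKaehler_apply]
  simp only [toT', toT'', nabla_end hJ.smoothEnd hX, hneg, nablaJ_neg_left hJ, map_add, map_neg,
    hJ.sq_eq_neg]
  abel

lemma SymmetricCondition.lieDerivForm_end (hsym : SymmetricCondition J)
    (hJ : IsAlmostHermitian J) (hσ : SmoothAt (sigma J) x) (u v : TangentSpace 𝓘(ℝ, E) x) :
    lieDerivForm (nablaLinear hσ) (sigma J x) (J x u) (J x v)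
      = lieDerivForm (nablaLinear hσ) (sigma J x) u v := by
  have hneg (v : TangentSpace 𝓘(ℝ, E) x) :
      nabla (sigma J) x (-v) = -nabla (sigma J) x v := map_neg (nablaLinear hσ) v
  have hre := congrArg Complex.re (hsym x _ _ (memT'_toT' hJ u) (memT'_toT' hJ v))
  simp only [cnabla_ofReal, toT', Complex.add_re, Complex.mul_re, complexMetric, hneg,
    inner_neg_left, inner_neg_right, neg_neg] at hre
  simp only [ofReal, inner_zero_left] at hre
  simp only [lieDerivForm_apply, nablaLinear_apply]
  linarith

end ComplexTangent

section HermitianFrame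

variable {E : Type*} [NormedAddCommGroup E] [NormedSpace ℝ E] [FiniteDimensional ℝ E]
  {M : Type*} [TopologicalSpace M] [ChartedSpace E M] [IsManifold 𝓘(ℝ, E) ∞ M]
  [RiemannianBundle (fun x : M ↦ TangentSpace 𝓘(ℝ, E) x)]
  [IsContMDiffRiemannianBundle 𝓘(ℝ, E) ∞ E (fun x : M ↦ TangentSpace 𝓘(ℝ, E) x)]
  {x : M} {J : EndField E M} {ξ e : VectorField E M}

lemma inv_sqrt_two_smul_inv_sqrt_two_smul {V : Type*} [AddCommGroup V] [Module ℝ V] (v : V) :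
    (√2)⁻¹ • (√2)⁻¹ • v = (1 / 2 : ℝ) • v := by
  rw [smul_smul, ← mul_inv, Real.mul_self_sqrt zero_le_two, one_div]

lemma twiceRePart'_cnabla_part''_cnabla (hJ : IsAlmostHermitian J)
    (hξ : ∀ᶠ y in 𝓝 x, SmoothAt ξ y) (he : SmoothAt e x) :
    twiceRePart' J x (cnabla (fun y ↦ part'' J (cnabla (fun z ↦ ofReal (ξ z)) y
        (cconj (hermitianVector J e y)))) x (hermitianVector J e x))
      = (1 / 4 : ℝ) • (quasiKaehler hJ x (e x) (nabla ξ x (e x))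
        + quasiKaehler hJ x (J x (e x)) (nabla ξ x (J x (e x)))) := by
  have hsmul (c : ℝ) (v : TangentSpace 𝓘(ℝ, E) x) : nabla ξ x (c • v) = c • nabla ξ x v :=
    map_smul (nablaLinear hξ.self_of_nhds) c v
  have hse : SmoothAt (fun y ↦ (√2)⁻¹ • e y) x := he.const_smul_section
  have hpart : SmoothAt (fun y ↦ (1 / 2 : ℝ) • (nabla ξ y ((√2)⁻¹ • e y)
      - J y (nabla ξ y (J y ((√2)⁻¹ • e y))))) x :=
    ((smoothAt_nabla hse hξ).sub_section (hJ.smoothEnd.smoothAt_apply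
      (smoothAt_nabla (hJ.smoothEnd.smoothAt_apply hse) hξ))).const_smul_section
  simp only [cconj_hermitianVector]
  simp only [cnabla_ofReal, part''_eq_toT'' hJ, hermitianVector_eq_toT']
  refine (twiceRePart'_cnabla_toT'' hJ hpart _).trans ?_
  simp only [map_smul, hsmul, map_sub, LinearMap.smul_apply, quasiKaehler_end_right,
    quasiKaehler_end_left, ← smul_sub]
  rw [inv_sqrt_two_smul_inv_sqrt_two_smul]
  module

lemma twiceRePart'_cnabla_cconj_part' (hJ : IsAlmostHermitian J) (hξ : SmoothAt ξ x)
    (he : SmoothAt e x) :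
    twiceRePart' J x (cnabla (fun y ↦ cconj (hermitianVector J e y)) x
        (part' J (cnabla (fun y ↦ ofReal (ξ y)) x (hermitianVector J e x))))
      = (1 / 4 : ℝ) • (quasiKaehler hJ x (nabla ξ x (e x)) (e x)
        + quasiKaehler hJ x (nabla ξ x (J x (e x))) (J x (e x))) := by
  have hneg (v : TangentSpace 𝓘(ℝ, E) x) : nabla ξ x (-v) = -nabla ξ x v :=
    map_neg (nablaLinear hξ) v
  have hsmul (c : ℝ) (v : TangentSpace 𝓘(ℝ, E) x) : nabla ξ x (c • v) = c • nabla ξ x v :=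
    map_smul (nablaLinear hξ) c v
  have hse : SmoothAt (fun y ↦ (√2)⁻¹ • e y) x := he.const_smul_section
  simp only [cconj_hermitianVector]
  simp only [cnabla_ofReal, part'_eq_toT' hJ, hermitianVector_eq_toT']
  refine (twiceRePart'_cnabla_toT'' hJ hse _).trans ?_
  simp only [toT', map_smul, map_neg, hsmul, hneg, map_add, LinearMap.smul_apply,
    LinearMap.add_apply, LinearMap.neg_apply, quasiKaehler_end_right, quasiKaehler_end_left,
    ← smul_neg, ← smul_add]
  rw [smul_comm _ (1 / 2 : ℝ), inv_sqrt_two_smul_inv_sqrt_two_smul]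
  module

lemma twiceRePart'_cnabla_part'' (hJ : IsAlmostHermitian J) (hξ : SmoothAt ξ x) :
    twiceRePart' J x (cnabla (fun y ↦ part'' J (ofReal (ξ y))) x (part' J (ofReal (ξ x))))
      = (1 / 4 : ℝ) • quasiKaehler hJ x (ξ x) (ξ x) := by
  have hpart : SmoothAt (fun y ↦ (1 / 2 : ℝ) • ξ y) x := hξ.const_smul_section
  simp only [ofReal, part'_eq_toT' hJ, part''_eq_toT'' hJ, map_zero, sub_zero, add_zero]
  refine (twiceRePart'_cnabla_toT'' hJ hpart _).trans ?_
  simp only [map_smul, LinearMap.smul_apply]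
  module

theorem VectorConditionAt.two_smul_eq_contraction {n : ℕ} {e : Fin n → VectorField E M} {U : Set M}
    (h : VectorConditionAt J e x) (hJ : IsAlmostHermitian J) (hU : IsOpen U) (hx : x ∈ U)
    (he : IsAdaptedFrameOn J e U) (hσ : ∀ᶠ y in 𝓝 x, SmoothAt (sigma J) y) :
    (2 : ℝ) • (roughLaplacian (sigma J) x + ricci x (sigma J x) - nabla (sigma J) x (sigma J x))
      = contraction (onb x) (lieDerivForm (nablaLinear hσ.self_of_nhds) (sigma J x))
        (quasiKaehler hJ x) := by
  obtain ⟨-, b, hb⟩ := (he.isOrthonormalFrameAt hJ.smoothEnd hU hx).self_of_nhds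
  have hre := twiceRePart'_eq_zero h
  rw [map_sub, map_smul, map_sub, map_sum] at hre
  simp only [map_add, twiceRePart'_cnabla_part''_cnabla hJ hσ (he.smoothAt hU hx _),
    twiceRePart'_cnabla_cconj_part' hJ hσ.self_of_nhds (he.smoothAt hU hx _),
    twiceRePart'_cnabla_part'' hJ hσ.self_of_nhds] at hre
  rw [ofReal, twiceRePart'_mk, map_zero, add_zero, sub_eq_zero] at hre
  rw [contraction_orthonormalBasis (onb x) b, contraction_lieDerivForm, Fintype.sum_sum_type, hre]
  simp only [hb, adaptedFrame, Sum.elim_inl, Sum.elim_inr, nablaLinear_apply, ← Finset.smul_sum,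
    Finset.sum_add_distrib]
  module

end HermitianFrame

section Holomorphic

variable {E : Type*} [NormedAddCommGroup E] [NormedSpace ℝ E] [FiniteDimensional ℝ E]
  {M : Type*} [TopologicalSpace M] [ChartedSpace E M] [IsManifold 𝓘(ℝ, E) ∞ M]
  [RiemannianBundle (fun x : M ↦ TangentSpace 𝓘(ℝ, E) x)]
  [IsContMDiffRiemannianBundle 𝓘(ℝ, E) ∞ E (fun x : M ↦ TangentSpace 𝓘(ℝ, E) x)]
  {F : Type*} [NormedAddCommGroup F] [NormedSpace ℝ F] [FiniteDimensional ℝ F]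
  {N : Type*} [TopologicalSpace N] [ChartedSpace F N] [IsManifold 𝓘(ℝ, F) ∞ N]
  [RiemannianBundle (fun p : N ↦ TangentSpace 𝓘(ℝ, F) p)]
  [IsContMDiffRiemannianBundle 𝓘(ℝ, F) ∞ F (fun p : N ↦ TangentSpace 𝓘(ℝ, F) p)]
  {φ : M → N} {J : EndField E M} {JN : EndField F N} {x : M}

theorem IsOneTwoSymplectic.two_smul_contraction_sffBilin (hN : IsOneTwoSymplectic JN)
    (hJ : IsAlmostHermitian J) (hJN : IsAlmostHermitian JN) (hφ : IsHolomorphic J JN φ)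
    {S : TangentSpace 𝓘(ℝ, E) x →ₗ[ℝ] TangentSpace 𝓘(ℝ, E) x →ₗ[ℝ] ℝ}
    (hS : ∀ u v, S u v = S v u) (hSJ : ∀ u v, S (J x u) (J x v) = S u v) :
    (2 : ℝ) • contraction (onb x) S (sffBilin hφ.smooth x)
      = -dmap E F φ x (contraction (onb x) S (quasiKaehler hJ x)) := by
  set B := sffBilin (F := F) hφ.smooth x
  set D := quasiKaehler hJ x
  set BJ := B.compl₁₂ (J x).toLinearMap (J x).toLinearMap
  have hBJ : contraction (onb x) S BJ = contraction (onb x) S B :=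
    contraction_compl₁₂_isometry (onb x) (hJ.isometryEquiv x) hSJ B
  have hBD : (B + BJ).compr₂ ((2 : ℝ) • LinearMap.id)
      = (D + D.flip).compr₂ (-(dmap E F φ x).toLinearMap) :=
    LinearMap.ext₂ fun u v ↦ hN.secondFundamentalForm_add_end hJ hJN hφ u v
  have hcontr := congrArg (contraction (onb x) S) hBD
  rw [contraction_compr₂, contraction_compr₂, contraction_add, contraction_add, hBJ,
    contraction_flip _ hS, ← two_smul ℝ (contraction _ _ B), ← two_smul ℝ (contraction _ _ D),
    map_smul, map_smul] at hcontr
  exact smul_right_injective _ (two_ne_zero (α := ℝ)) hcontr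

end Holomorphic

end BiharmonicHolomorphic

end

theorem theorem1
    {E : Type*} [NormedAddCommGroup E] [NormedSpace ℝ E] [FiniteDimensional ℝ E]
    {M : Type*} [TopologicalSpace M] [ChartedSpace E M] [IsManifold 𝓘(ℝ, E) ∞ M]
    [RiemannianBundle (fun x : M ↦ TangentSpace 𝓘(ℝ, E) x)]
    [IsContMDiffRiemannianBundle 𝓘(ℝ, E) ∞ E (fun x : M ↦ TangentSpace 𝓘(ℝ, E) x)]
    (J : EndField E M) (hJ : IsAlmostHermitian J)
    (hsym : SymmetricCondition J) (hvec : VectorCondition J)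
    {F : Type*} [NormedAddCommGroup F] [NormedSpace ℝ F] [FiniteDimensional ℝ F]
    {N : Type*} [TopologicalSpace N] [ChartedSpace F N] [IsManifold 𝓘(ℝ, F) ∞ N]
    [RiemannianBundle (fun p : N ↦ TangentSpace 𝓘(ℝ, F) p)]
    [IsContMDiffRiemannianBundle 𝓘(ℝ, F) ∞ F (fun p : N ↦ TangentSpace 𝓘(ℝ, F) p)]
    (JN : EndField F N) (hJN : IsAlmostHermitian JN) (hN : IsOneTwoSymplectic JN)
    (φ : M → N) (hφ : IsHolomorphic J JN φ) :
    IsBiharmonic E F φ := by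
  have hσ (y : M) : SmoothAt (sigma J) y := by
    obtain ⟨U, n, e, hU, hy, he, -⟩ := hvec y
    exact hJ.smoothEnd.smoothAt_apply
      ((he.isOrthonormalFrameAt hJ.smoothEnd hU hy).smoothAt_divJ hJ.smoothEnd)
  intro x
  obtain ⟨U, n, e, hU, hx, he, hv⟩ := hvec x
  have hbitension := (he.isOrthonormalFrameAt hJ.smoothEnd hU hx).bitension_eq hφ.smooth
    (.of_forall hσ) (hN.tension_eq hJ hJN hφ)
  have hvector := hv.two_smul_eq_contraction hJ hU hx he (.of_forall hσ)
  have hcontraction := hN.two_smul_contraction_sffBilin hJ hJN hφ (lieDerivForm_comm _ _)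
    (hsym.lieDerivForm_end hJ (hσ x))
  rw [← hvector, map_smul, ← smul_neg] at hcontraction
  rw [hbitension, smul_right_injective _ (two_ne_zero (α := ℝ)) hcontraction, add_neg_cancel,
    neg_zero]
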